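/- Let $n\ge 1$ and let $s=(s_1,\dots,s_{n-1})=(2,3,\dots,n)$. Let \[ P_{n-1}^s=\{x\in\mathbb{R}^{n-1} : 0\le \tfrac{x_1}{s_1}\le \tfrac{x_2}{s_2}\le\cdots\le\tfrac{x_{n-1}}{s_{n-1}}\le 1\} \] be the $s$-lecture hall simplex. The local $h^*$-polynomial (box polynomial) of a lattice simplex $P\subset\mathbb{R}^m$ with vertices $v_0,\dots,v_d$ is $\ell^*(P;z)=\sum z^{x_{m+1}}$, the sum being over all lattice points $(x_1,\dots,x_{m+1})\in\mathbb{Z}^{m+1}$ of the open parallelepiped $\{\sum_{i}\lambda_i(v_i,1) : 0<\lambda_i<1\}$; the $s$-derangement polynomial is $d_{n-1}^s(z)=\ell^*(P_{n-1}^s;z)$. Let $\mathfrak{D}_n$ be the set of permutations $\pi$ of $\{1,\dots,n\}$ without fixed points, let $\mathrm{exc}(\pi)=|\{i:\pi(i)>i\}|$, and let $d_n(z)=\sum_{\pi\in\mathfrak{D}_n}z^{\mathrm{exc}(\pi)}$ be the classical derangement polynomial. Theorem. (1) $d_{n-1}^s(z)=d_n(z)$. (2) Put $s_0=s_n=1$,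 and let $\widetilde{I}_{n-1}^s$ be the set of integer sequences $e=(e_0,\dots,e_n)$ with $0\le e_i<s_i$ for all $i$ and $\frac{e_i}{s_i}\ne\frac{e_{i+1}}{s_{i+1}}$ for $0\le i\le n-1$; let $\mathrm{des}(e)$ be the number of $0\le i\le n-1$ with $\frac{e_i}{s_i}>\frac{e_{i+1}}{s_{i+1}}$. For $e\in\widetilde{I}_{n-1}^s$ define a permutation $f(e)$ of $\{1,\dots,n\}$ by its cycles as follows: start with $A=\{1,\dots,n\}$ and an empty current cycle and read $e_n,e_{n-1},\dots,e_0$ in this order; if $e_i=0$, close off the current cycle (if it is nonempty), start a new cycle at $\min A$ (if $A\neq\emptyset$) and remove $\min A$ from $A$; if $e_i\ne 0$, append the $e_i$-th smallest element of $A$ to the current cycle and remove it from $A$. Then $f$ is a bijection from $\widetilde{I}_{n-1}^s$ onto $\mathfrak{D}_n$, and $\mathrm{exc}(f(e))=\mathrm{des}(e)$ for every $e\in\widetilde{I}_{n-1}^s$. (3) The local $h$-polynomial of the barycentric subdivision $\Omega$ of the $(n-1)$-simplex $2^{V}$, $|V|=n$, equals the local $h^*$-polynomial $\ell^*(P_{n-1}^s;z)$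 of the $s$-lecture hall simplex $P_{n-1}^s$. Here the faces of $\Omega$ are the chains of nonempty subsets of $V$, $\Omega_F$ (for $F\subseteq V$) is the subcomplex of chains of nonempty subsets of $F$, the $h$-polynomial of a $(d-1)$-dimensional simplicial complex with $f_{k-1}$ faces of $k$ vertices (and $f_{-1}=1$) is $\sum_{k=0}^d f_{k-1}z^k(1-z)^{d-k}$, and the local $h$-polynomial is $\sum_{F\subseteq V}(-1)^{n-|F|}h(\Omega_F;z)$. -/

import Mathlib

open Polynomial

/-! ### Derangement polynomials -/

/-- The number of excedances of a permutation: the number of `i` with `π i > i`. -/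
def excCount {n : ℕ} (π : Equiv.Perm (Fin n)) : ℕ :=
  (Finset.univ.filter fun i => i < π i).card

/-- The classical derangement polynomial `d_n(z) = ∑ z ^ exc(π)`, the sum being over the
derangements (fixed-point free permutations) of an `n`-element set. -/
noncomputable def derangementPolynomial (n : ℕ) : ℤ[X] :=
  ∑ π : derangements (Fin n), X ^ excCount (π : Equiv.Perm (Fin n))

/-! ### Local `h^*`-polynomials and lecture hall simplices -/

/-- The open parallelepiped `{∑ λ_v (v, 1) : 0 < λ_v < 1}` of the polytope `P`, the sum being over
the vertices `v` of `P`. -/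
noncomputable def openParallelepiped {n : ℕ} (P : Set (Fin n → ℝ)) : Set ((Fin n → ℝ) × ℝ) :=
  {y | ∃ c : (Fin n → ℝ) → ℝ, (∀ v ∈ P.extremePoints ℝ, 0 < c v ∧ c v < 1) ∧
    y = ∑ᶠ v ∈ P.extremePoints ℝ, c v • (v, (1 : ℝ))}

/-- The lattice points `(x, k)` in the open parallelepiped of `P`. -/
def boxPoints {n : ℕ} (P : Set (Fin n → ℝ)) : Set ((Fin n → ℤ) × ℤ) :=
  {x | ((fun i => (x.1 i : ℝ)), (x.2 : ℝ)) ∈ openParallelepiped P}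

/-- The local `h^*`-polynomial (box polynomial) of a lattice simplex `P`: the generating function
of the lattice points of the open parallelepiped of `P` by their last coordinate. For a lattice
simplex there are finitely many such points and their last coordinates are nonnegative. -/
noncomputable def localHStarPolynomial {n : ℕ} (P : Set (Fin n → ℝ)) : ℤ[X] :=
  ∑ᶠ x ∈ boxPoints P, X ^ x.2.toNat

/-- The `s`-lecture hall simplex `{x : 0 ≤ x_1 / s_1 ≤ x_2 / s_2 ≤ ⋯ ≤ x_n / s_n ≤ 1}`. -/
def lectureHallSimplex {n : ℕ} (s : Fin n → ℕ) : Set (Fin n → ℝ) :=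
  {x | (∀ i, 0 ≤ x i / (s i : ℝ)) ∧
    (∀ i j, i ≤ j → x i / (s i : ℝ) ≤ x j / (s j : ℝ)) ∧
    (∀ i, x i / (s i : ℝ) ≤ 1)}

/-- The `s`-derangement polynomial `d_n^s(z)` of a sequence `s = (s_1, …, s_n)` of positive
integers. -/
noncomputable def sDerangementPolynomial {n : ℕ} (s : Fin n → ℕ) : ℤ[X] :=
  localHStarPolynomial (lectureHallSimplex s)

/-! ### Inversion sequences -/

/-- The `s`-inversion sequences: integer sequences with `0 ≤ e_i < s_i` for all `i`. -/
def inversionSequences {n : ℕ} (s : Fin n → ℕ) : Set (Fin n → ℕ) :=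
  {e | ∀ i, e i < s i}

/-- The sequence `(1, s_1, …, s_n, 1)`, indexed from `0` to `n + 1`. -/
def padSequence {n : ℕ} (s : Fin n → ℕ) : Fin (n + 2) → ℕ :=
  Fin.cons 1 (Fin.snoc s 1 : Fin (n + 1) → ℕ)

/-- The restricted inversion sequences: the inversion sequences `(e_0, e_1, …, e_{n+1})` of
`(s_0, …, s_{n+1}) = (1, s_1, …, s_n, 1)` with `e_i / s_i ≠ e_{i+1} / s_{i+1}` for
`0 ≤ i ≤ n`. -/
def restrictedInversionSequences {n : ℕ} (s : Fin n → ℕ) : Set (Fin (n + 2) → ℕ) :=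
  {e | e ∈ inversionSequences (padSequence s) ∧ ∀ i : Fin (n + 1),
    (e i.castSucc : ℚ) / padSequence s i.castSucc ≠ (e i.succ : ℚ) / padSequence s i.succ}

/-- The number of descents of `e = (e_0, …, e_{n+1})` with respect to
`(s_0, …, s_{n+1}) = (1, s_1, …, s_n, 1)`: the number of `0 ≤ i ≤ n` with
`e_i / s_i > e_{i+1} / s_{i+1}`. -/
def desCount {n : ℕ} (s : Fin n → ℕ) (e : Fin (n + 2) → ℕ) : ℕ :=
  (Finset.univ.filter fun i : Fin (n + 1) =>
    (e i.castSucc : ℚ) / padSequence s i.castSucc > (e i.succ : ℚ) / padSequence s i.succ).card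

/-- Read a word of natural numbers from left to right, keeping the list `A` of available elements
and the current cycle `c`. On reading `0`, close off the current cycle and start a new cycle at
the first available element; on reading `j + 1`, append to the current cycle the `(j + 1)`-st
available element. Every element used is removed from `A`. The result is the product of the cycles
produced (a list `[a, b, …, y, z]` stands for the cycle `a ↦ b ↦ ⋯ ↦ y ↦ z ↦ a`). -/
def cyclesFromWord {α : Type*} [DecidableEq α] : List ℕ → List α → List α → Equiv.Perm α
  | [], _, c => c.formPerm
  | 0 :: w, A, c => c.formPerm * cyclesFromWord w (A.drop 1) (A.take 1)
  | (j + 1) :: w, A, c => cyclesFromWord w (A.eraseIdx j) (c ++ A[j]?.toList)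

/-- The permutation of an `n`-element set obtained by reading the sequence
`(e_0, e_1, …)` from right to left by `cyclesFromWord`, starting with all elements available
(in increasing order) and an empty current cycle. -/
def inversionSequenceToPerm (n : ℕ) {m : ℕ} (e : Fin m → ℕ) : Equiv.Perm (Fin n) :=
  cyclesFromWord (List.ofFn e).reverse (List.finRange n) []

/-! ### Local `h`-polynomials and the barycentric subdivision -/

/-- The number `f_{k-1}` of faces with `k` vertices; `f_{-1} = 1` counts the empty face, which is
not an element of `K.faces` in Mathlib's convention. -/
noncomputable def faceNumber {ι : Type*} (K : PreAbstractSimplicialComplex ι) (k : ℕ) : ℕ :=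
  if k = 0 then 1 else {σ ∈ K.faces | σ.card = k}.ncard

/-- The dimension plus one: the maximal number of vertices of a face (`0` if only the empty face is
present). -/
noncomputable def dimSucc {ι : Type*} (K : PreAbstractSimplicialComplex ι) : ℕ :=
  sSup (Finset.card '' K.faces)

/-- The `h`-polynomial of a `(d-1)`-dimensional simplicial complex,
`(1 - z)^d f(z / (1 - z)) = ∑_{k=0}^d f_{k-1} z^k (1 - z)^(d-k)`. -/
noncomputable def hPolynomial {ι : Type*} [Finite ι] (K : PreAbstractSimplicialComplex ι) : ℤ[X] :=
  ∑ k ∈ Finset.range (dimSucc K + 1),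
    C (faceNumber K k : ℤ) * X ^ k * (1 - X) ^ (dimSucc K - k)

/-- A simplicial complex with an order-preserving map from its faces to the faces of the simplex
`2^V`. A subdivision of `2^V` is such a complex, with the map sending a face to the smallest face of
`2^V` that contains it. -/
structure ComplexOverSimplex (V ι : Type*) extends PreAbstractSimplicialComplex ι where
  /-- the face of `2^V` carrying a given face -/
  carrier : Finset ι → Finset V
  carrier_mono : ∀ σ ∈ faces, ∀ τ ∈ faces, σ ⊆ τ → carrier σ ⊆ carrier τ

/-- The subcomplex `Ω_F` of the faces carried by a face of `2^F`. -/
def ComplexOverSimplex.over {V ι : Type*} (Ω : ComplexOverSimplex V ι) (F : Finset V) :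
    PreAbstractSimplicialComplex ι where
  faces := {σ | σ ∈ Ω.faces ∧ Ω.carrier σ ⊆ F}
  isRelLowerSet_faces := by
    rintro σ ⟨hσ, hF⟩
    refine ⟨(Ω.isRelLowerSet_faces hσ).1, fun τ hτσ hτ => ?_⟩
    have h := (Ω.isRelLowerSet_faces hσ).2 hτσ hτ
    exact ⟨h, (Ω.carrier_mono τ h σ hσ hτσ).trans hF⟩

/-- The local `h`-polynomial `ℓ_F(Ω_F; z) = ∑_{G ⊆ F} (-1)^(|F| - |G|) h(Ω_G; z)`. -/
noncomputable def localHPolynomial {V ι : Type*} [Finite ι] (Ω : ComplexOverSimplex V ι)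
    (F : Finset V) : ℤ[X] :=
  ∑ G ∈ F.powerset, (-1) ^ (F.card - G.card) * hPolynomial (Ω.over G)

/-- The defining relation of the local `h`-polynomials: `h(Ω_F; z) = ∑_{G ⊆ F} ℓ_G(Ω_G; z)`. -/
theorem hPolynomial_eq_sum_localHPolynomial {V ι : Type*} [DecidableEq V] [Finite ι]
    (Ω : ComplexOverSimplex V ι) (F : Finset V) :
    hPolynomial (Ω.over F) = ∑ G ∈ F.powerset, localHPolynomial Ω G := by
  unfold localHPolynomial
  rw [Finset.sum_comm' (t' := F.powerset) (s' := fun H => Finset.Icc H F)]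
  · simp_rw [← Finset.sum_mul]
    rw [Finset.sum_eq_single_of_mem F (by simp)]
    · simp
    · intro H hH hne
      have hH' : H ⊆ F := Finset.mem_powerset.1 hH
      suffices ∑ G ∈ Finset.Icc H F, (-1 : ℤ[X]) ^ (G.card - H.card) = 0 by rw [this, zero_mul]
      rw [Finset.Icc_eq_image_powerset hH', Finset.sum_image]
      · have h0 : (F \ H).Nonempty := by
          rw [Finset.sdiff_nonempty]
          exact fun h => hne (Finset.Subset.antisymm hH' h)
        have h1 := Finset.sum_powerset_neg_one_pow_card_of_nonempty h0
        have h2 : ∑ G ∈ (F \ H).powerset, (-1 : ℤ[X]) ^ G.card = 0 := by exact_mod_cast congrArg (Int.cast : ℤ → ℤ[X]) h1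
        rw [← h2]
        refine Finset.sum_congr rfl fun G hG => ?_
        have hd : Disjoint H G :=
          (Finset.disjoint_sdiff).mono_right (Finset.mem_powerset.1 hG)
        rw [Finset.card_union_of_disjoint hd, Nat.add_sub_cancel_left]
      · intro G hG G' hG' h
        have hd : Disjoint H G :=
          (Finset.disjoint_sdiff).mono_right (Finset.mem_powerset.1 hG)
        have hd' : Disjoint H G' :=
          (Finset.disjoint_sdiff).mono_right (Finset.mem_powerset.1 hG')
        have := congrArg (· \ H) h
        simpa [Finset.union_sdiff_cancel_left hd, Finset.union_sdiff_cancel_left hd'] using this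
  · intro G H
    simp only [Finset.mem_powerset, Finset.mem_Icc]
    exact ⟨fun h => ⟨⟨h.2, h.1⟩, h.2.trans h.1⟩, fun h => ⟨h.1.2, h.1.1⟩⟩

/-- The barycentric subdivision of the simplex `2^V`: its vertices are the nonempty faces of `2^V`,
its faces are the chains of nonempty faces of `2^V`, and a chain is carried by its largest
element. -/
def barycentricSubdivision (V : Type*) [DecidableEq V] : ComplexOverSimplex V (Finset V) where
  faces := {σ | σ.Nonempty ∧ (∀ G ∈ σ, G.Nonempty) ∧ IsChain (· ⊆ ·) (σ : Set (Finset V))}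
  isRelLowerSet_faces := by
    rintro σ ⟨h1, h2, h3⟩
    exact ⟨h1, fun τ hτσ hτ => ⟨hτ, fun G hG => h2 G (hτσ hG), h3.mono (by exact_mod_cast hτσ)⟩⟩
  carrier σ := σ.sup id
  carrier_mono _ _ _ _ h := Finset.sup_mono h

/-! Both local polynomials are shown to equal the derangement polynomial. For the barycentric
subdivision, the h-polynomial over a face with `n` vertices is the Eulerian polynomial in the
excedance statistic: both satisfy `P (n + 1) = (1 + n z) P n + z (1 - z) (P n)'`
(`chainPolynomial_succ`, `excPolynomial_succ`). The Eulerian polynomial of a face `F` is a sum over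
the permutations supported in `F`, so the alternating sum over `F` keeps only those of full support,
the derangements. For the lecture hall simplex, the coefficients of a point of the parallelepiped
are the consecutive differences of `0, x_1/s_1, …, k`. Division with remainder, `x_i = e_i + s_i
q_i`, turns the condition that they lie in `(0, 1)` into: consecutive fractions `e_i/s_i` differ,
and `q` rises by one exactly at the descents. Hence the height `k` is `des e`
(`bijOn_boxPointOfSequence`). For `s = (2, 3, …)`, neighbouring fractions agree only if both entries
are `0`, so no cycle of length one is ever closed. A descent from `e_i` to `e_{i+1}` means `e_i ≠ 0`
and `e_{i+1} ≤ e_i`; in the reading of cycles this says that the newly appended element exceeds its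
predecessor. An arc that closes a cycle leads to its least element and is never an excedance. This
gives `exc = des` (`IsCycleWord.extends_cyclesFromWord`). The image of the last element of the
current cycle determines the next letter, whence bijectivity. -/

/-! ### Counting chains of sets -/

/-- The number of chains of `k` nonempty subsets of an `n`-element set that contain the whole set
(for `n = k = 0`, the empty chain is counted). -/
def topChainCount : ℕ → ℕ → ℕ
  | n, 0 => if n = 0 then 1 else 0
  | n, k + 1 => ∑ m ∈ Finset.range n, n.choose m * topChainCount m k

/-- The number of chains of `k` nonempty subsets of an `n`-element set. -/
def chainCount (n k : ℕ) : ℕ :=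
  ∑ m ∈ Finset.range (n + 1), n.choose m * topChainCount m k

/-- A chain either contains the whole set or gains one member when the whole set is adjoined. In the
sum this is the term `m = n` split off. -/
theorem chainCount_eq (n k : ℕ) :
    chainCount n k = topChainCount n (k + 1) + topChainCount n k := by
  simp [chainCount, topChainCount, Finset.sum_range_succ]

theorem chainCount_zero_right (n : ℕ) : chainCount n 0 = 1 := by
  simp [chainCount, topChainCount]

/-- Chains ending in the whole set are ordered set partitions, so the numbers are `k! S(n, k)` and
this is the Stirling recurrence. In the induction, Pascal's rule splits the sum: one half is a
`chainCount`, the other falls to the induction hypothesis. -/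
theorem topChainCount_succ_succ (n k : ℕ) :
    topChainCount (n + 1) (k + 1) =
      (k + 1) * (topChainCount n (k + 1) + topChainCount n k) := by
  induction k generalizing n with
  | zero =>
    rcases n with _ | n <;> simp [topChainCount]
  | succ k ih =>
    have h1 : topChainCount (n + 1) (k + 2) =
        ∑ m ∈ Finset.range n, n.choose m * topChainCount (m + 1) (k + 1) +
          (∑ m ∈ Finset.range n, n.choose (m + 1) * topChainCount (m + 1) (k + 1) +
            topChainCount 0 (k + 1)) := by
      rw [topChainCount, Finset.sum_range_succ', ← add_assoc, ← Finset.sum_add_distrib]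
      simp [Nat.choose_succ_succ, add_mul]
    have h2 : ∑ m ∈ Finset.range n, n.choose (m + 1) * topChainCount (m + 1) (k + 1) +
            topChainCount 0 (k + 1) = topChainCount n (k + 2) + topChainCount n (k + 1) := by
      rw [← chainCount_eq, chainCount, Finset.sum_range_succ']
      simp
    have h3 : ∑ m ∈ Finset.range n, n.choose m * topChainCount (m + 1) (k + 1) =
        (k + 1) * (topChainCount n (k + 2) + topChainCount n (k + 1)) := by
      simp_rw [ih]
      rw [topChainCount, topChainCount, ← Finset.sum_add_distrib, Finset.mul_sum]
      exact Finset.sum_congr rfl fun m _ => by ring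
    rw [h1, h2, h3]
    ring

theorem topChainCount_eq_zero {n k : ℕ} (h : n < k) : topChainCount n k = 0 := by
  induction k generalizing n with
  | zero => omega
  | succ k ih =>
    refine Finset.sum_eq_zero fun m hm => ?_
    rw [ih (by have := Finset.mem_range.1 hm; omega), mul_zero]

theorem topChainCount_self_pos (n : ℕ) : 0 < topChainCount n n := by
  induction n with
  | zero => simp [topChainCount]
  | succ n ih =>
    rw [topChainCount_succ_succ]
    positivity

theorem chainCount_eq_zero {n k : ℕ} (h : n < k) : chainCount n k = 0 := by
  rw [chainCount_eq, topChainCount_eq_zero h, topChainCount_eq_zero (h.trans k.lt_succ_self)]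

theorem chainCount_self_pos (n : ℕ) : 0 < chainCount n n := by
  rw [chainCount_eq]
  exact Nat.add_pos_right _ (topChainCount_self_pos n)

theorem chainCount_succ_succ (n k : ℕ) :
    chainCount (n + 1) (k + 1) = (k + 1) * chainCount n k + (k + 2) * chainCount n (k + 1) := by
  simp only [chainCount_eq, topChainCount_succ_succ]
  ring

/-! ### Face numbers of the barycentric subdivision -/

open Classical in
/-- The chains of `k` nonempty sets with union `G`. -/
noncomputable def topChains {V : Type*} [Fintype V] [DecidableEq V] (G : Finset V) (k : ℕ) :
    Finset (Finset (Finset V)) :=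
  Finset.univ.filter fun σ => (∀ H ∈ σ, H.Nonempty) ∧
    IsChain (· ⊆ ·) (σ : Set (Finset V)) ∧ σ.card = k ∧ σ.sup id = G

theorem sup_mem_of_isChain {V : Type*} [DecidableEq V] {σ : Finset (Finset V)}
    (hc : IsChain (· ⊆ ·) (σ : Set (Finset V))) (hσ : σ.Nonempty) : σ.sup id ∈ σ := by
  obtain ⟨M, hM, hmax⟩ := σ.exists_max_image Finset.card hσ
  have : σ.sup id = M := by
    apply le_antisymm
    · refine Finset.sup_le fun H hH => ?_
      rcases hc.total hH hM with h | h
      · exact h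
      · exact (Finset.eq_of_subset_of_card_le h (hmax H hH)).ge
    · exact Finset.le_sup (f := id) hM
  rwa [this]

/-- Setting the weight to `0` at the full cardinality reduces this to the sum over all subsets. -/
theorem sum_ssubsets_card {V M : Type*} [DecidableEq V] [AddCommMonoid M] (G : Finset V)
    (f : ℕ → M) :
    ∑ H ∈ G.ssubsets, f H.card = ∑ m ∈ Finset.range G.card, G.card.choose m • f m := by
  rcases G.eq_empty_or_nonempty with rfl | hG
  · simp [Finset.ssubsets]
  · have h : ∀ n : ℕ, ∑ m ∈ Finset.range n, n.choose m • f m =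
        ∑ m ∈ Finset.range (n + 1), n.choose m • (if m = n then 0 else f m) := by
      intro n
      rw [Finset.sum_range_succ]
      simp only [if_true, smul_zero, add_zero]
      refine Finset.sum_congr rfl fun m hm => ?_
      rw [if_neg (Finset.mem_range.1 hm).ne]
    rw [h, ← Finset.sum_powerset_apply_card (fun m => if m = G.card then 0 else f m),
      ← Finset.sum_subset (Finset.erase_subset G G.powerset : G.ssubsets ⊆ _)]
    · refine Finset.sum_congr rfl fun H hH => ?_
      rw [if_neg (Finset.card_lt_card (Finset.mem_ssubsets.1 hH)).ne]
    · intro H hH hH'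
      have : H = G := by
        by_contra hne
        exact hH' (Finset.mem_erase.2 ⟨hne, hH⟩)
      simp [this]

/-- Removing the top member `G` leaves a chain whose union `H` is a proper subset of `G`, and
adjoining `G` undoes this. The fibre over `H` is counted by induction. -/
theorem card_topChains {V : Type*} [Fintype V] [DecidableEq V] (G : Finset V) (k : ℕ) :
    (topChains G k).card = topChainCount G.card k := by
  induction k generalizing G with
  | zero =>
    have : topChains G 0 = if G = ∅ then {∅} else ∅ := by
      ext σ
      simp only [topChains, Finset.mem_filter, Finset.mem_univ, true_and]
      split_ifs with h
      · simp only [Finset.mem_singleton]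
        constructor
        · rintro ⟨-, -, h, -⟩
          exact Finset.card_eq_zero.1 h
        · rintro rfl
          simp [h]
      · simp only [Finset.notMem_empty, iff_false]
        rintro ⟨-, -, h1, h2⟩
        rw [Finset.card_eq_zero.1 h1] at h2
        exact h (by simpa using h2.symm)
    rw [this, topChainCount]
    by_cases h : G = ∅ <;> simp [h]
  | succ k ih =>
    have hmaps : ∀ σ ∈ topChains G (k + 1), (σ.erase G).sup id ∈ G.ssubsets := by
      intro σ hσ
      simp only [topChains, Finset.mem_filter, Finset.mem_univ, true_and] at hσ
      obtain ⟨h1, h2, h3, h4⟩ := hσ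
      have hG : G ∈ σ := h4 ▸ sup_mem_of_isChain h2 (Finset.card_pos.1 (by omega))
      rw [Finset.mem_ssubsets, Finset.ssubset_iff_subset_ne]
      refine ⟨h4 ▸ Finset.sup_mono (Finset.erase_subset _ _), fun he => ?_⟩
      rcases (σ.erase G).eq_empty_or_nonempty with h0 | h0
      · rw [h0] at he
        exact (h1 G hG).ne_empty (by simpa using he.symm)
      · have := sup_mem_of_isChain (h2.mono (by simp)) h0
        rw [he] at this
        simp at this
    rw [Finset.card_eq_sum_card_fiberwise hmaps, topChainCount,
      show (∑ m ∈ Finset.range G.card, G.card.choose m * topChainCount m k) =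
        ∑ m ∈ Finset.range G.card, G.card.choose m • topChainCount m k from rfl,
      ← sum_ssubsets_card]
    refine Finset.sum_congr rfl fun H hH => ?_
    rw [← ih]
    have hHG := Finset.mem_ssubsets.1 hH
    refine Finset.card_bij' (fun σ _ => σ.erase G) (fun σ _ => insert G σ) ?_ ?_ ?_ ?_
    · intro σ hσ
      simp only [topChains, Finset.mem_filter, Finset.mem_univ, true_and] at hσ ⊢
      obtain ⟨⟨h1, h2, h3, h4⟩, h5⟩ := hσ
      have hG : G ∈ σ := h4 ▸ sup_mem_of_isChain h2 (Finset.card_pos.1 (by omega))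
      refine ⟨fun K hK => h1 K (Finset.mem_of_mem_erase hK), h2.mono (by simp), ?_, h5⟩
      rw [Finset.card_erase_of_mem hG, h3, Nat.add_sub_cancel]
    · intro σ hσ
      simp only [topChains, Finset.mem_filter, Finset.mem_univ, true_and] at hσ ⊢
      obtain ⟨h1, h2, h3, h4⟩ := hσ
      have hle : ∀ K ∈ σ, K ⊆ H := fun K hK => h4 ▸ Finset.le_sup (f := id) hK
      have hG : G ∉ σ := fun h => hHG.not_subset (hle G h)
      refine ⟨⟨?_, ?_, ?_, ?_⟩, ?_⟩
      · intro K hK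
        rcases Finset.mem_insert.1 hK with rfl | hK
        · exact (Finset.sdiff_nonempty.2 hHG.not_subset).mono Finset.sdiff_subset
        · exact h1 K hK
      · rw [Finset.coe_insert]
        exact h2.insert fun K hK _ => Or.inr ((hle K hK).trans hHG.subset)
      · rw [Finset.card_insert_of_notMem hG, h3]
      · rw [Finset.sup_insert, h4]
        exact sup_eq_left.2 hHG.subset
      · rw [Finset.erase_insert hG, h4]
    · intro σ hσ
      simp only [topChains, Finset.mem_filter, Finset.mem_univ, true_and] at hσ
      obtain ⟨⟨h1, h2, h3, h4⟩, h5⟩ := hσ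
      exact Finset.insert_erase (h4 ▸ sup_mem_of_isChain h2 (Finset.card_pos.1 (by omega)))
    · intro σ hσ
      simp only [topChains, Finset.mem_filter, Finset.mem_univ, true_and] at hσ
      refine Finset.erase_insert fun h => hHG.not_subset ?_
      exact hσ.2.2.2 ▸ Finset.le_sup (f := id) h

theorem faceNumber_barycentricSubdivision_over {V : Type*} [Fintype V] [DecidableEq V]
    (F : Finset V) (k : ℕ) :
    faceNumber ((barycentricSubdivision V).over F) k = chainCount F.card k := by
  rw [faceNumber]
  split_ifs with hk
  · rw [hk, chainCount_zero_right]
  · have : {σ ∈ ((barycentricSubdivision V).over F).faces | σ.card = k} =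
        ((F.powerset.biUnion fun G => topChains G k : Finset (Finset (Finset V))) :
          Set (Finset (Finset V))) := by
      ext σ
      simp only [ComplexOverSimplex.over, barycentricSubdivision, topChains, Set.mem_ofPred_eq,
        Finset.coe_biUnion, Finset.mem_coe, Finset.mem_powerset, Set.mem_iUnion, Finset.mem_filter,
        Finset.mem_univ, true_and, exists_prop]
      constructor
      · rintro ⟨⟨⟨-, h1, h2⟩, h3⟩, h4⟩
        exact ⟨_, h3, h1, h2, h4, rfl⟩
      · rintro ⟨G, h1, h2, h3, h4, rfl⟩
        exact ⟨⟨⟨Finset.card_pos.1 (by omega), h2, h3⟩, h1⟩, h4⟩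
    rw [this, Set.ncard_coe_finset, Finset.card_biUnion]
    · simp_rw [card_topChains]
      rw [Finset.sum_powerset_apply_card (fun m => topChainCount m k)]
      rfl
    · intro G _ G' _ hne
      refine Finset.disjoint_left.2 fun σ h h' => hne ?_
      simp only [topChains, Finset.mem_filter] at h h'
      rw [← h.2.2.2.2, ← h'.2.2.2.2]

/-- The dimension is read off the face numbers: they vanish above `F.card` and are positive at
`F.card`. For empty `F` there are no faces and `sSup ∅ = 0`. -/
theorem dimSucc_barycentricSubdivision_over {V : Type*} [Fintype V] [DecidableEq V]
    (F : Finset V) : dimSucc ((barycentricSubdivision V).over F) = F.card := by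
  have hmem : ∀ σ ∈ ((barycentricSubdivision V).over F).faces, σ.card ≤ F.card := by
    intro σ hσ
    by_contra! hlt
    have h0 := faceNumber_barycentricSubdivision_over F σ.card
    rw [chainCount_eq_zero hlt, faceNumber, if_neg (by omega),
      Set.ncard_eq_zero (Set.toFinite _)] at h0
    exact Set.notMem_empty σ (h0 ▸ ⟨hσ, rfl⟩)
  rw [dimSucc]
  rcases Nat.eq_zero_or_pos F.card with h | h
  · rw [h]
    refine Nat.eq_zero_of_le_zero (csSup_le' ?_)
    rintro _ ⟨σ, hσ, rfl⟩
    exact h ▸ hmem σ hσ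
  · refine IsGreatest.csSup_eq ⟨?_, ?_⟩
    · have h0 := faceNumber_barycentricSubdivision_over F F.card
      have h1 := chainCount_self_pos F.card
      rw [← h0, faceNumber, if_neg h.ne', Set.ncard_pos (Set.toFinite _)] at h1
      obtain ⟨σ, hσ, hk⟩ := h1
      exact ⟨σ, hσ, hk⟩
    · rintro _ ⟨σ, hσ, rfl⟩
      exact hmem σ hσ

/-! ### Eulerian polynomials -/

/-- The `h`-polynomial of the barycentric subdivision of a simplex with `n` vertices. -/
noncomputable def chainPolynomial (n : ℕ) : ℤ[X] :=
  ∑ k ∈ Finset.range (n + 1), C (chainCount n k : ℤ) * X ^ k * (1 - X) ^ (n - k)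

theorem hPolynomial_barycentricSubdivision_over {V : Type*} [Fintype V] [DecidableEq V]
    (F : Finset V) : hPolynomial ((barycentricSubdivision V).over F) = chainPolynomial F.card := by
  simp only [hPolynomial, dimSucc_barycentricSubdivision_over,
    faceNumber_barycentricSubdivision_over, chainPolynomial]

theorem chainPolynomial_zero : chainPolynomial 0 = 1 := by
  simp [chainPolynomial, chainCount_zero_right]

/-- The polynomials `X ^ k * (1 - X) ^ (n - k)` are eigenvectors of the Eulerian operator, with
eigenvalue `k + 1`. -/
theorem eulerian_operator_apply {n k : ℕ} (hk : k ≤ n) (c : ℤ) :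
    (1 + (n : ℤ[X]) * X) * (C c * X ^ k * (1 - X) ^ (n - k)) +
      X * (1 - X) * derivative (C c * X ^ k * (1 - X) ^ (n - k)) =
    C c * ((k : ℤ[X]) + 1) * X ^ k * (1 - X) ^ (n - k) := by
  obtain ⟨m, rfl⟩ := Nat.exists_eq_add_of_le hk
  rw [Nat.add_sub_cancel_left, mul_assoc, derivative_C_mul, derivative_mul, derivative_X_pow,
    derivative_pow]
  -- The factor `X` absorbs the truncated exponent `k - 1`, which is harmless at `k = 0` because the
  -- coefficient vanishes.
  have h1 : X * (C (k : ℤ) * X ^ (k - 1)) = (k : ℤ[X]) * X ^ k := by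
    cases k with
    | zero => simp
    | succ k => simp; ring
  have h2 : (1 - X) * (C (m : ℤ) * (1 - X) ^ (m - 1)) = (m : ℤ[X]) * (1 - X) ^ m := by
    cases m with
    | zero => simp
    | succ k => simp; ring
  have h3 : derivative (1 - X : ℤ[X]) = -1 := by simp
  rw [h3]
  push_cast
  linear_combination C c * (1 - X) * (1 - X) ^ m * h1 - C c * X * X ^ k * h2

theorem chainPolynomial_succ (n : ℕ) :
    chainPolynomial (n + 1) = (1 + (n : ℤ[X]) * X) * chainPolynomial n +
      X * (1 - X) * derivative (chainPolynomial n) := by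
  have h1 : (1 + (n : ℤ[X]) * X) * chainPolynomial n +
      X * (1 - X) * derivative (chainPolynomial n) =
      ∑ k ∈ Finset.range (n + 1), C (chainCount n k : ℤ) * ((k : ℤ[X]) + 1) * X ^ k * (1 - X) ^ (n - k) := by
    rw [chainPolynomial, derivative_sum, Finset.mul_sum, Finset.mul_sum, ← Finset.sum_add_distrib]
    exact Finset.sum_congr rfl fun k hk =>
      eulerian_operator_apply (Nat.lt_succ_iff.1 (Finset.mem_range.1 hk)) _
  -- A zero term at `k = n + 1` is added before the index shift; the term `k = 0` becomes `(1 - X) ^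
  -- (n + 1)`.
  have h2 : ∑ k ∈ Finset.range (n + 1),
      C (chainCount n k : ℤ) * ((k : ℤ[X]) + 1) * X ^ k * (1 - X) ^ (n + 1 - k) =
      ∑ k ∈ Finset.range (n + 1),
        C (chainCount n (k + 1) : ℤ) * ((k : ℤ[X]) + 2) * X ^ (k + 1) * (1 - X) ^ (n - k) +
        (1 - X) ^ (n + 1) := by
    have := Finset.sum_range_succ
      (fun k => C (chainCount n k : ℤ) * ((k : ℤ[X]) + 1) * X ^ k * (1 - X) ^ (n + 1 - k)) (n + 1)
    rw [chainCount_eq_zero n.lt_succ_self] at this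
    simp only [Nat.cast_zero, C_0, zero_mul, add_zero] at this
    rw [← this, Finset.sum_range_succ']
    simp only [chainCount_zero_right, Nat.add_sub_add_right]
    simp only [Nat.cast_add, Nat.cast_one, Nat.cast_zero, C_1]
    congr 1
    · exact Finset.sum_congr rfl fun k _ => by ring
    · simp
  rw [h1, chainPolynomial, Finset.sum_range_succ']
  simp only [chainCount_zero_right, chainCount_succ_succ, Nat.add_sub_add_right]
  -- Each term is multiplied by `1 = X + (1 - X)` to raise the total degree to `n + 1`, so that
  -- `chainCount_succ_succ` compares coefficients.
  have h3 : ∑ k ∈ Finset.range (n + 1),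
      C (chainCount n k : ℤ) * ((k : ℤ[X]) + 1) * X ^ k * (1 - X) ^ (n - k) =
      ∑ k ∈ Finset.range (n + 1),
        C (chainCount n k : ℤ) * ((k : ℤ[X]) + 1) * X ^ (k + 1) * (1 - X) ^ (n - k) +
      ∑ k ∈ Finset.range (n + 1),
        C (chainCount n k : ℤ) * ((k : ℤ[X]) + 1) * X ^ k * (1 - X) ^ (n + 1 - k) := by
    rw [← Finset.sum_add_distrib]
    refine Finset.sum_congr rfl fun k hk => ?_
    rw [Nat.succ_sub (Nat.lt_succ_iff.1 (Finset.mem_range.1 hk)), pow_succ (1 - X)]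
    ring
  rw [h3, h2, ← add_assoc, ← Finset.sum_add_distrib]
  congr 1
  · refine Finset.sum_congr rfl fun k _ => ?_
    push_cast
    simp only [map_add, map_mul, map_natCast, map_ofNat, map_one]
    ring
  · simp

/-- The Eulerian polynomial `∑ z ^ exc(π)`, the sum being over all permutations of an `n`-element
set. -/
noncomputable def excPolynomial (n : ℕ) : ℤ[X] :=
  ∑ π : Equiv.Perm (Fin n), X ^ excCount π

theorem excCount_le {n : ℕ} (π : Equiv.Perm (Fin n)) : excCount π ≤ n :=
  (Finset.card_le_univ _).trans_eq (Fintype.card_fin n)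

theorem excCount_decomposeFin_symm_zero {n : ℕ} (π : Equiv.Perm (Fin n)) :
    excCount (Equiv.Perm.decomposeFin.symm (0, π)) = excCount π := by
  simp only [excCount, Finset.card_filter, Fin.sum_univ_succ]
  simp

/-- The new least element `0` is inserted into the arc from `i` to `π i`. It becomes an excedance,
while `i` now maps to `0` and is none. -/
theorem excCount_decomposeFin_symm_succ {n : ℕ} (π : Equiv.Perm (Fin n)) (i : Fin n) :
    excCount (Equiv.Perm.decomposeFin.symm ((π i).succ, π)) =
      if i < π i then excCount π else excCount π + 1 := by
  simp only [excCount, Finset.card_filter, Fin.sum_univ_succ]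
  have h : ∀ j, (if j.succ < Equiv.Perm.decomposeFin.symm ((π i).succ, π) j.succ then 1 else 0) =
      if j = i then 0 else if j < π j then 1 else 0 := by
    intro j
    rw [Equiv.Perm.decomposeFin_symm_apply_succ]
    by_cases hj : j = i
    · simp [hj]
    · rw [Equiv.swap_apply_of_ne_of_ne (Fin.succ_ne_zero _)
        (fun h => hj (π.injective (Fin.succ_injective _ h)))]
      simp [hj]
  simp_rw [h]
  rw [← Finset.add_sum_erase _ _ (Finset.mem_univ i),
    ← Finset.add_sum_erase Finset.univ (fun j => if j < π j then 1 else 0) (Finset.mem_univ i)]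
  have h' : ∑ j ∈ Finset.univ.erase i, (if j = i then 0 else if j < π j then 1 else 0) =
      ∑ j ∈ Finset.univ.erase i, if j < π j then 1 else 0 :=
    Finset.sum_congr rfl fun j hj => by rw [if_neg (Finset.ne_of_mem_erase hj)]
  rw [h']
  split_ifs <;> simp_all; omega

/-- A permutation with `e` excedances yields `1 + e` insertions of `0` that keep `e` (as a fixed
point or into an excedance arc) and `n - e` that raise it by one. -/
theorem excPolynomial_succ (n : ℕ) :
    excPolynomial (n + 1) = (1 + (n : ℤ[X]) * X) * excPolynomial n +
      X * (1 - X) * derivative (excPolynomial n) := by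
  rw [excPolynomial, ← Equiv.sum_comp Equiv.Perm.decomposeFin.symm, Fintype.sum_prod_type_right,
    excPolynomial, derivative_sum, Finset.mul_sum, Finset.mul_sum, ← Finset.sum_add_distrib]
  refine Finset.sum_congr rfl fun π _ => ?_
  rw [Fin.sum_univ_succ, excCount_decomposeFin_symm_zero,
    ← Equiv.sum_comp π fun j => (X : ℤ[X]) ^ excCount (Equiv.Perm.decomposeFin.symm (j.succ, π))]
  simp_rw [excCount_decomposeFin_symm_succ, apply_ite (fun k => (X : ℤ[X]) ^ k)]
  rw [Finset.sum_ite, Finset.sum_const, Finset.sum_const, ← excCount]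
  have h1 : (Finset.univ.filter fun i => ¬ i < π i).card = n - excCount π := by
    have := Finset.card_filter_add_card_filter_not (s := Finset.univ) (fun i => i < π i)
    rw [Finset.card_univ, Fintype.card_fin, ← excCount] at this
    omega
  rw [h1, derivative_X_pow, nsmul_eq_mul, nsmul_eq_mul, Nat.cast_sub (excCount_le π)]
  have h2 : X * (C (excCount π : ℤ) * X ^ (excCount π - 1)) =
      (excCount π : ℤ[X]) * X ^ excCount π := by
    cases excCount π with
    | zero => simp
    | succ k => simp; ring
  linear_combination -(1 - X) * h2

theorem excPolynomial_eq_chainPolynomial (n : ℕ) : excPolynomial n = chainPolynomial n := by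
  induction n with
  | zero => simp [excPolynomial, chainPolynomial_zero, excCount]
  | succ n ih => rw [excPolynomial_succ, chainPolynomial_succ, ih]

/-! ### The local `h`-polynomial of the barycentric subdivision -/

/-- The increasing bijection onto `F` preserves excedances, and the fixed points outside `F`
contribute none. -/
theorem excPolynomial_card {n : ℕ} (F : Finset (Fin n)) :
    excPolynomial F.card =
      ∑ π : Equiv.Perm (Fin n) with π.support ⊆ F, X ^ excCount π := by
  have hφ := F.orderIsoOfFin (k := F.card) rfl
  rw [excPolynomial, ← Equiv.sum_comp (Equiv.permCongr hφ.toEquiv).symm,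
    ← Equiv.sum_comp (Equiv.Perm.subtypeEquivSubtypePerm (· ∈ F)).symm,
    Finset.sum_subtype (p := fun π : Equiv.Perm (Fin n) => ∀ a, a ∉ F → π a = a)]
  · refine Finset.sum_congr rfl fun π _ => ?_
    congr 1
    obtain ⟨π, hπ⟩ := π
    refine Finset.card_bij (fun i _ => (hφ i : Fin n)) ?_ ?_ ?_
    · intro i hi
      rw [Finset.mem_filter] at hi ⊢
      have := hi.2
      rw [← hφ.lt_iff_lt] at this
      simpa [Equiv.permCongr_apply, Equiv.Perm.subtypeEquivSubtypePerm, ← Subtype.coe_lt_coe] using this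
    · intro i _ j _ h
      exact hφ.injective (Subtype.ext h)
    · intro i hi
      rw [Finset.mem_filter] at hi
      have hiF : i ∈ F := by
        by_contra h
        exact (hπ i h ▸ hi.2).false
      refine ⟨hφ.symm ⟨i, hiF⟩, ?_, by simp⟩
      rw [Finset.mem_filter, ← hφ.lt_iff_lt]
      simpa [Equiv.permCongr_apply, Equiv.Perm.subtypeEquivSubtypePerm, ← Subtype.coe_lt_coe] using hi.2
  · intro π
    simp only [Finset.mem_filter, Finset.mem_univ, true_and, Finset.subset_iff,
      Equiv.Perm.mem_support]
    exact forall_congr' fun a => not_imp_comm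

theorem sum_superset_neg_one_pow {V : Type*} [Fintype V] [DecidableEq V] (T : Finset V) :
    ∑ F ∈ Finset.univ.powerset with T ⊆ F, (-1 : ℤ[X]) ^ ((Finset.univ : Finset V).card - F.card) =
      if T = Finset.univ then 1 else 0 := by
  have h : ∑ F ∈ Finset.univ.powerset with T ⊆ F,
      (-1 : ℤ[X]) ^ ((Finset.univ : Finset V).card - F.card) =
      ∑ F ∈ Tᶜ.powerset, (-1 : ℤ[X]) ^ F.card := by
    refine Finset.sum_bij' (fun F _ => Fᶜ) (fun F _ => Fᶜ) ?_ ?_ (by simp) (by simp) ?_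
    · intro F hF
      simpa using hF
    · intro F hF
      simpa [Finset.subset_compl_comm] using hF
    · intro F _
      rw [Finset.card_compl, Finset.card_univ]
  rw [h]
  have := congrArg (Int.cast : ℤ → ℤ[X]) (Finset.sum_powerset_neg_one_pow_card (x := Tᶜ))
  push_cast at this
  rw [this]
  simp [Finset.compl_eq_empty_iff]

/-- After the sums are exchanged, `π` is weighted by the signed count of the supersets of its
support, which is zero unless the support is everything. -/
theorem localHPolynomial_barycentricSubdivision (n : ℕ) :
    localHPolynomial (barycentricSubdivision (Fin n)) Finset.univ = derangementPolynomial n := by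
  have h : localHPolynomial (barycentricSubdivision (Fin n)) Finset.univ =
      ∑ π : Equiv.Perm (Fin n), if π.support = Finset.univ then X ^ excCount π else 0 := by
    simp only [localHPolynomial, hPolynomial_barycentricSubdivision_over,
      ← excPolynomial_eq_chainPolynomial, excPolynomial_card, Finset.mul_sum]
    rw [Finset.sum_comm' (t' := Finset.univ)
      (s' := fun π => Finset.univ.powerset.filter fun F => π.support ⊆ F) (by simp)]
    refine Finset.sum_congr rfl fun π _ => ?_
    rw [← Finset.sum_mul, sum_superset_neg_one_pow, ite_mul, one_mul, zero_mul]
  rw [h, derangementPolynomial, ← Finset.sum_filter,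
    Finset.sum_subtype (p := fun π => π ∈ derangements (Fin n))]
  intro π
  simp [derangements, Finset.eq_univ_iff_forall]

/-! ### The lattice points in the open parallelepiped of a lecture hall simplex -/

/-- The sequence `(a, x_1, …, x_n, b)`, indexed from `0` to `n + 1`. -/
def padWith {α : Type*} {n : ℕ} (a : α) (x : Fin n → α) (b : α) : Fin (n + 2) → α :=
  Fin.cons a (Fin.snoc x b : Fin (n + 1) → α)

section padWith

variable {α : Type*} {n : ℕ} (a : α) (x : Fin n → α) (b : α)

@[simp]
theorem padWith_zero : padWith a x b 0 = a := rfl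

@[simp]
theorem padWith_castSucc_succ (i : Fin n) : padWith a x b i.castSucc.succ = x i := by
  simp [padWith]

theorem padWith_last : padWith a x b (Fin.last n).succ = b := by
  simp [padWith]

@[simp]
theorem padWith_last' : padWith a x b (Fin.last (n + 1)) = b :=
  padWith_last a x b

end padWith

theorem padSequence_eq_padWith {n : ℕ} (s : Fin n → ℕ) : padSequence s = padWith 1 s 1 := rfl

theorem forall_fin_add_two {n : ℕ} {p : Fin (n + 2) → Prop} :
    (∀ i, p i) ↔ p 0 ∧ (∀ i : Fin n, p i.castSucc.succ) ∧ p (Fin.last n).succ := by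
  rw [Fin.forall_fin_succ, Fin.forall_fin_succ']

theorem padSequence_pos {n : ℕ} {s : Fin n → ℕ} (hs : ∀ i, 0 < s i) (i : Fin (n + 2)) :
    0 < padSequence s i := by
  revert i
  rw [forall_fin_add_two, padSequence_eq_padWith]
  simpa using hs

theorem sum_ite_le_sub {n : ℕ} (t : Fin (n + 2) → ℝ) (i : Fin (n + 1)) :
    ∑ j : Fin (n + 1), (if j ≤ i then t j.succ - t j.castSucc else 0) = t i.succ - t 0 := by
  induction i using Fin.induction with
  | zero =>
    rw [Finset.sum_eq_single_of_mem 0 (Finset.mem_univ _)]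
    · simp
    · intro j _ hj
      rw [if_neg (by simpa using hj)]
  | succ i ih =>
    have h : ∀ j : Fin (n + 1), (if j ≤ i.succ then t j.succ - t j.castSucc else 0) =
        (if j ≤ i.castSucc then t j.succ - t j.castSucc else 0) +
          if j = i.succ then t j.succ - t j.castSucc else 0 := by
      intro j
      by_cases h1 : j = i.succ
      · subst h1
        rw [if_pos le_rfl, if_neg (by simp [Fin.le_def]), if_pos rfl, zero_add]
      · have : j ≤ i.succ ↔ j ≤ i.castSucc := by
          rw [Fin.ext_iff, Fin.val_succ] at h1
          rw [Fin.le_def, Fin.le_def, Fin.val_succ, Fin.val_castSucc]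
          omega
        rw [if_neg h1, add_zero]
        simp only [this]
    simp_rw [h]
    rw [Finset.sum_add_distrib, ih, Finset.sum_ite_eq' Finset.univ i.succ,
      if_pos (Finset.mem_univ _), ← Fin.succ_castSucc]
    ring

/-- The vertices of the lecture hall simplex: the points `(0, …, 0, s_j, …, s_n)`. -/
def lectureHallVertex {n : ℕ} (s : Fin n → ℕ) (j : Fin (n + 1)) : Fin n → ℝ :=
  fun i => if j ≤ i.castSucc then (s i : ℝ) else 0

section lectureHall

variable {n : ℕ} {s : Fin n → ℕ}

theorem lectureHallVertex_mem (hs : ∀ i, 0 < s i) (j : Fin (n + 1)) :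
    lectureHallVertex s j ∈ lectureHallSimplex s := by
  have h : ∀ i, lectureHallVertex s j i / (s i : ℝ) = if j ≤ i.castSucc then 1 else 0 := by
    intro i
    have : (s i : ℝ) ≠ 0 := by exact_mod_cast (hs i).ne'
    rw [lectureHallVertex]
    split_ifs
    · exact div_self this
    · exact zero_div _
  refine ⟨fun i => ?_, fun i k hik => ?_, fun i => ?_⟩
  · rw [h]; split_ifs <;> norm_num
  · rw [h, h]
    by_cases h1 : j ≤ i.castSucc
    · rw [if_pos h1, if_pos (h1.trans (Fin.castSucc_le_castSucc_iff.2 hik))]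
    · rw [if_neg h1]; split_ifs <;> norm_num
  · rw [h]; split_ifs <;> norm_num

theorem lectureHallVertex_injective (hs : ∀ i, 0 < s i) :
    Function.Injective (lectureHallVertex s) := by
  have key : ∀ j k : Fin (n + 1), j < k → lectureHallVertex s j ≠ lectureHallVertex s k := by
    intro j k hjk h
    have hj : (j : ℕ) < n := lt_of_lt_of_le hjk (Nat.lt_succ_iff.1 k.2)
    have := congrFun h ⟨j, hj⟩
    have h0 : (s ⟨j, hj⟩ : ℝ) ≠ 0 := by exact_mod_cast (hs _).ne'
    rw [lectureHallVertex, lectureHallVertex, if_pos (show j ≤ Fin.castSucc ⟨j, hj⟩ from le_rfl),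
      if_neg (show ¬k ≤ Fin.castSucc ⟨j, hj⟩ from not_le.2 hjk)] at this
    exact h0 this
  intro j k h
  rcases lt_trichotomy j k with hjk | hjk | hjk
  · exact (key j k hjk h).elim
  · exact hjk
  · exact (key k j hjk h.symm).elim

/-- The barycentric coordinates are the consecutive differences of `0, x_1/s_1, …, x_n/s_n, 1`,
whose sum telescopes to `1`. -/
theorem mem_convexHull_lectureHallVertex (hs : ∀ i, 0 < s i) {x : Fin n → ℝ}
    (hx : x ∈ lectureHallSimplex s) : x ∈ convexHull ℝ (Set.range (lectureHallVertex s)) := by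
  obtain ⟨h0, h1, h2⟩ := hx
  set t : Fin (n + 2) → ℝ := padWith 0 (fun i => x i / (s i : ℝ)) 1 with ht
  have hmono : ∀ j : Fin (n + 1), 0 ≤ t j.succ - t j.castSucc := by
    intro j
    rw [sub_nonneg]
    induction j using Fin.cases with
    | zero =>
      rcases n with _ | n
      · rw [ht, show (0 : Fin 1) = Fin.last 0 from rfl, padWith_last]
        simp
      · have : (0 : Fin (n + 2)).succ = (0 : Fin (n + 1)).castSucc.succ := rfl
        rw [this, ht, padWith_castSucc_succ, Fin.castSucc_zero, padWith_zero]
        exact h0 0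
    | succ j =>
      rw [← Fin.succ_castSucc, ht, padWith_castSucc_succ]
      rcases Fin.eq_castSucc_or_eq_last j.succ with ⟨k, hk⟩ | hk
      · rw [hk, padWith_castSucc_succ]
        refine h1 j k ?_
        rw [Fin.ext_iff] at hk
        rw [Fin.le_def]
        simp at hk
        omega
      · rw [hk, padWith_last]
        exact h2 j
  have hsum : ∑ j : Fin (n + 1), (t j.succ - t j.castSucc) = 1 := by
    have := sum_ite_le_sub t (Fin.last n)
    simp only [Fin.le_last, if_true] at this
    rw [this, ht, padWith_last, padWith_zero, sub_zero]
  have hx : x = ∑ j : Fin (n + 1), (t j.succ - t j.castSucc) • lectureHallVertex s j := by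
    funext i
    have h := sum_ite_le_sub t i.castSucc
    have hi : (s i : ℝ) ≠ 0 := by exact_mod_cast (hs i).ne'
    rw [ht, padWith_castSucc_succ, padWith_zero, sub_zero, eq_div_iff hi, ← ht,
      Finset.sum_mul] at h
    rw [← h, Finset.sum_apply]
    refine Finset.sum_congr rfl fun j _ => ?_
    simp [lectureHallVertex]
  rw [hx]
  exact (convex_convexHull ℝ _).sum_mem (fun j _ => hmono j) hsum
    fun j _ => subset_convexHull ℝ _ ⟨j, rfl⟩

theorem convex_lectureHallSimplex (s : Fin n → ℕ) : Convex ℝ (lectureHallSimplex s) := by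
  rintro x ⟨hx0, hx1, hx2⟩ y ⟨hy0, hy1, hy2⟩ a b ha hb hab
  have h : ∀ i, (a • x + b • y) i / (s i : ℝ) = a * (x i / s i) + b * (y i / s i) := by
    intro i
    simp only [Pi.add_apply, Pi.smul_apply, smul_eq_mul]
    ring
  refine ⟨fun i => ?_, fun i j hij => ?_, fun i => ?_⟩
  · rw [h]
    exact add_nonneg (mul_nonneg ha (hx0 i)) (mul_nonneg hb (hy0 i))
  · rw [h, h]
    exact add_le_add (mul_le_mul_of_nonneg_left (hx1 i j hij) ha)
      (mul_le_mul_of_nonneg_left (hy1 i j hij) hb)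
  · rw [h]
    have := add_le_add (mul_le_mul_of_nonneg_left (hx2 i) ha)
      (mul_le_mul_of_nonneg_left (hy2 i) hb)
    linarith

theorem nonneg_of_div {a b : ℝ} (hb : 0 < b) (h : 0 ≤ a / b) : 0 ≤ a :=
  (div_mul_cancel₀ a hb.ne') ▸ mul_nonneg h hb.le

/-- Each coordinate of a vertex is an endpoint of the interval `[0, s i]` that contains that
coordinate throughout the simplex, so no proper convex combination reaches it. -/
theorem extremePoints_lectureHallSimplex (hs : ∀ i, 0 < s i) :
    (lectureHallSimplex s).extremePoints ℝ = Set.range (lectureHallVertex s) := by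
  apply Set.Subset.antisymm
  · have : lectureHallSimplex s = convexHull ℝ (Set.range (lectureHallVertex s)) := by
      refine Set.Subset.antisymm (fun x hx => mem_convexHull_lectureHallVertex hs hx) ?_
      refine convexHull_min ?_ (convex_lectureHallSimplex s)
      rintro _ ⟨j, rfl⟩
      exact lectureHallVertex_mem hs j
    rw [this]
    exact extremePoints_convexHull_subset
  · rintro _ ⟨j, rfl⟩
    rw [mem_extremePoints_iff_left]
    refine ⟨lectureHallVertex_mem hs j, ?_⟩
    rintro x ⟨hx0, -, hx2⟩ y ⟨hy0, -, hy2⟩ ⟨a, b, ha, hb, hab, h⟩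
    funext i
    have hi : (0 : ℝ) < s i := by exact_mod_cast hs i
    have h1 := congrFun h i
    simp only [Pi.add_apply, Pi.smul_apply, smul_eq_mul, lectureHallVertex] at h1 ⊢
    have x0 := nonneg_of_div hi (hx0 i)
    have y0 := nonneg_of_div hi (hy0 i)
    have x2 := (div_le_one hi).1 (hx2 i)
    have y2 := (div_le_one hi).1 (hy2 i)
    split_ifs at h1 ⊢
    · have e1 : a * (s i - x i) + b * (s i - y i) = 0 := by
        linear_combination (s i : ℝ) * hab - h1
      have := mul_nonneg ha.le (sub_nonneg.2 x2)
      have := mul_nonneg hb.le (sub_nonneg.2 y2)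
      have e2 : a * (s i - x i) = 0 := by linarith
      rcases mul_eq_zero.1 e2 with h | h <;> linarith
    · have := mul_nonneg ha.le x0
      have := mul_nonneg hb.le y0
      have e2 : a * x i = 0 := by linarith
      rcases mul_eq_zero.1 e2 with h | h <;> linarith

/-- Vertex `j` contributes to the scaled coordinate `i` exactly when `j ≤ i`. The padded scaled
coordinates are therefore the partial sums of the coefficients, and the coefficients are their
differences. -/
theorem mem_openParallelepiped_lectureHallSimplex (hs : ∀ i, 0 < s i) (x : Fin n → ℝ) (k : ℝ) :
    (x, k) ∈ openParallelepiped (lectureHallSimplex s) ↔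
      ∀ i : Fin (n + 1), 0 < padWith 0 (fun i => x i / (s i : ℝ)) k i.succ -
          padWith 0 (fun i => x i / (s i : ℝ)) k i.castSucc ∧
        padWith 0 (fun i => x i / (s i : ℝ)) k i.succ -
          padWith 0 (fun i => x i / (s i : ℝ)) k i.castSucc < 1 := by
  set t : Fin (n + 2) → ℝ := padWith 0 (fun i => x i / (s i : ℝ)) k with ht
  have hinj := lectureHallVertex_injective hs
  simp only [openParallelepiped, extremePoints_lectureHallSimplex hs, Set.mem_ofPred_eq,
    Set.forall_mem_range, finsum_mem_range hinj, finsum_eq_sum_of_fintype]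
  have hcoord : ∀ c : Fin (n + 1) → ℝ,
      (x, k) = ∑ j, c j • (lectureHallVertex s j, (1 : ℝ)) ↔
        ∀ i, t i.succ = ∑ j, if j ≤ i then c j else 0 := by
    intro c
    rw [Prod.ext_iff, Prod.fst_sum, Prod.snd_sum, Fin.forall_fin_succ', funext_iff]
    simp only [ht, padWith_castSucc_succ, padWith_last, Fin.le_last, if_true, Prod.smul_mk,
      smul_eq_mul, mul_one, Finset.sum_apply, Pi.smul_apply]
    refine and_congr (forall_congr' fun i => ?_) Iff.rfl
    have hi : (s i : ℝ) ≠ 0 := by exact_mod_cast (hs i).ne'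
    rw [div_eq_iff hi, Finset.sum_mul]
    refine Eq.congr rfl (Finset.sum_congr rfl fun j _ => ?_)
    simp [lectureHallVertex]
  constructor
  · rintro ⟨c, hc, h⟩
    rw [hcoord] at h
    suffices ∀ i : Fin (n + 1), t i.succ - t i.castSucc = c (lectureHallVertex s i) by
      intro i
      rw [this]
      exact hc i
    intro i
    induction i using Fin.cases with
    | zero =>
      rw [h, Fin.castSucc_zero, ht, padWith_zero, sub_zero,
        Finset.sum_eq_single_of_mem 0 (Finset.mem_univ _)]
      · simp
      · intro j _ hj
        rw [if_neg (by simpa using hj)]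
    | succ i =>
      rw [h, ← Fin.succ_castSucc, h, ← Finset.sum_sub_distrib,
        Finset.sum_eq_single_of_mem i.succ (Finset.mem_univ _)]
      · rw [if_pos le_rfl, if_neg (by simp [Fin.le_def]), sub_zero]
      · intro j _ hj
        have : j ≤ i.succ ↔ j ≤ i.castSucc := by
          rw [Ne, Fin.ext_iff, Fin.val_succ] at hj
          rw [Fin.le_def, Fin.le_def, Fin.val_succ, Fin.val_castSucc]
          omega
        simp only [this, sub_self]
  · intro h
    -- Coefficients are functions on the whole space, so the values prescribed at the distinct
    -- vertices have to be extended.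
    obtain ⟨c, hc⟩ := Function.Injective.surjective_comp_right (γ := ℝ) hinj
      fun j => t j.succ - t j.castSucc
    have hc' : ∀ j, c (lectureHallVertex s j) = t j.succ - t j.castSucc := congrFun hc
    refine ⟨c, fun j => by rw [hc']; exact h j, ?_⟩
    rw [hcoord]
    intro i
    simp_rw [hc']
    rw [sum_ite_le_sub, ht, padWith_zero, sub_zero]

theorem mem_boxPoints_lectureHallSimplex (hs : ∀ i, 0 < s i) (x : (Fin n → ℤ) × ℤ) :
    x ∈ boxPoints (lectureHallSimplex s) ↔ ∀ i : Fin (n + 1),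
      0 < ((padWith 0 x.1 x.2 i.succ : ℤ) : ℚ) / padSequence s i.succ -
          ((padWith 0 x.1 x.2 i.castSucc : ℤ) : ℚ) / padSequence s i.castSucc ∧
        ((padWith 0 x.1 x.2 i.succ : ℤ) : ℚ) / padSequence s i.succ -
          ((padWith 0 x.1 x.2 i.castSucc : ℤ) : ℚ) / padSequence s i.castSucc < 1 := by
  rw [boxPoints, Set.mem_ofPred_eq, mem_openParallelepiped_lectureHallSimplex hs]
  have h : ∀ i, padWith 0 (fun i => (x.1 i : ℝ) / (s i : ℝ)) (x.2 : ℝ) i =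
      ((((padWith 0 x.1 x.2 i : ℤ) : ℚ) / padSequence s i : ℚ) : ℝ) := by
    rw [forall_fin_add_two]
    simp [padSequence_eq_padWith]
  simp only [h]
  exact forall_congr' fun i => by norm_cast

/-! ### Box points and restricted inversion sequences -/

/-- The number of descents of `e` before the position `i`. -/
def desCountBefore (s : Fin n → ℕ) (e : Fin (n + 2) → ℕ) (i : Fin (n + 2)) : ℕ :=
  (Finset.univ.filter fun j : Fin (n + 1) => j.castSucc < i ∧
    (e j.castSucc : ℚ) / padSequence s j.castSucc > (e j.succ : ℚ) / padSequence s j.succ).card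

theorem desCountBefore_zero (e : Fin (n + 2) → ℕ) : desCountBefore s e 0 = 0 := by
  simp [desCountBefore]

theorem desCountBefore_last (e : Fin (n + 2) → ℕ) :
    desCountBefore s e (Fin.last n).succ = desCount s e := by
  simp [desCountBefore, desCount, Fin.castSucc_lt_last]

theorem desCountBefore_succ (e : Fin (n + 2) → ℕ) (i : Fin (n + 1)) :
    desCountBefore s e i.succ = desCountBefore s e i.castSucc +
      if (e i.castSucc : ℚ) / padSequence s i.castSucc > (e i.succ : ℚ) / padSequence s i.succ
      then 1 else 0 := by
  simp only [desCountBefore, Finset.card_filter]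
  rw [← Finset.add_sum_erase _ _ (Finset.mem_univ i), add_comm,
    ← Finset.add_sum_erase Finset.univ (fun j => if j.castSucc < i.castSucc ∧ _ then 1 else 0)
      (Finset.mem_univ i)]
  congr 1
  · simp only [lt_self_iff_false, false_and, if_false, zero_add]
    refine Finset.sum_congr rfl fun j hj => ?_
    have hj := Finset.ne_of_mem_erase hj
    have : j.castSucc < i.succ ↔ j.castSucc < i.castSucc := by
      rw [Ne, Fin.ext_iff] at hj
      rw [Fin.lt_def, Fin.lt_def]
      simp only [Fin.val_castSucc, Fin.val_succ]
      omega
    simp only [this]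
  · simp

/-- The lattice point of the open parallelepiped of the lecture hall simplex that corresponds to a
restricted inversion sequence. -/
def boxPointOfSequence (s : Fin n → ℕ) (e : Fin (n + 2) → ℕ) : (Fin n → ℤ) × ℤ :=
  (fun i => e i.castSucc.succ + s i * desCountBefore s e i.castSucc.succ, desCount s e)

/-- Both end entries of `e` are less than `1`, hence zero, so the formula for the inner coordinates
persists at the ends. -/
theorem padWith_boxPointOfSequence {e : Fin (n + 2) → ℕ}
    (he : e ∈ restrictedInversionSequences s) (i : Fin (n + 2)) :
    padWith 0 (boxPointOfSequence s e).1 (boxPointOfSequence s e).2 i =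
      e i + padSequence s i * desCountBefore s e i := by
  have h0 := he.1 0
  have h1 := he.1 (Fin.last n).succ
  rw [padSequence_eq_padWith, padWith_zero, Nat.lt_one_iff] at h0
  rw [padSequence_eq_padWith, padWith_last, Nat.lt_one_iff] at h1
  revert i
  rw [forall_fin_add_two, padSequence_eq_padWith]
  simp only [padWith_zero, padWith_castSucc_succ, padWith_last, desCountBefore_zero,
    desCountBefore_last, h0, h1, boxPointOfSequence]
  simp

theorem div_mem_Ico {a b : ℕ} (h : a < b) : 0 ≤ (a : ℚ) / b ∧ (a : ℚ) / b < 1 := by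
  have hb : (0 : ℚ) < b := by exact_mod_cast (Nat.zero_le a).trans_lt h
  exact ⟨by positivity, by rw [div_lt_one hb]; exact_mod_cast h⟩

theorem bijOn_boxPointOfSequence (hs : ∀ i, 0 < s i) :
    Set.BijOn (boxPointOfSequence s) (restrictedInversionSequences s)
      (boxPoints (lectureHallSimplex s)) := by
  have hS := padSequence_pos hs
  have hS' : ∀ i, (padSequence s i : ℚ) ≠ 0 := fun i => by exact_mod_cast (hS i).ne'
  refine ⟨fun e he => ?_, fun e he e' he' h => ?_, fun x hx => ?_⟩
  · rw [mem_boxPoints_lectureHallSimplex hs]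
    intro i
    rw [padWith_boxPointOfSequence he, padWith_boxPointOfSequence he, desCountBefore_succ]
    push_cast
    rw [add_div, add_div, mul_div_cancel_left₀ _ (hS' _), mul_div_cancel_left₀ _ (hS' _)]
    obtain ⟨a0, a1⟩ := div_mem_Ico (he.1 i.succ)
    obtain ⟨b0, b1⟩ := div_mem_Ico (he.1 i.castSucc)
    have hne := he.2 i
    split_ifs with h
    · constructor <;> linarith
    · have := lt_of_le_of_ne (not_lt.1 h) hne
      constructor <;> linarith
  -- The entry `e i` is the residue of the padded coordinate modulo `s_i`.
  · funext i
    have h1 := padWith_boxPointOfSequence he i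
    rw [h, padWith_boxPointOfSequence he' i] at h1
    have h2 := congrArg (· % (padSequence s i : ℤ)) h1
    simp only [Int.add_mul_emod_self_left] at h2
    have h3 := Nat.mod_eq_of_lt (he.1 i)
    have h4 := Nat.mod_eq_of_lt (he'.1 i)
    rw [← h3, ← h4]
    exact_mod_cast h2.symm
  · rw [mem_boxPoints_lectureHallSimplex hs] at hx
    set Y : Fin (n + 2) → ℤ := padWith 0 x.1 x.2 with hY
    set e : Fin (n + 2) → ℕ := fun i => (Y i % padSequence s i).toNat with he
    have hecast : ∀ i, (e i : ℤ) = Y i % padSequence s i := fun i =>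
      Int.toNat_of_nonneg (Int.emod_nonneg _ (by exact_mod_cast (hS i).ne'))
    have helt : ∀ i, e i < padSequence s i := fun i => by
      have := Int.emod_lt_of_pos (Y i) (b := padSequence s i) (by exact_mod_cast hS i)
      rw [← hecast] at this
      exact_mod_cast this
    have hYe : ∀ i, Y i = e i + padSequence s i * (Y i / padSequence s i) := fun i => by
      rw [hecast, Int.emod_add_mul_ediv]
    have hdiv : ∀ i, (Y i : ℚ) / padSequence s i =
        (e i : ℚ) / padSequence s i + ((Y i / padSequence s i : ℤ) : ℚ) := fun i => by
      have := congrArg (Int.cast : ℤ → ℚ) (hYe i)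
      push_cast at this
      rw [this, add_div, mul_div_cancel_left₀ _ (hS' i)]
    -- With fractional parts `a`, `b` in `[0, 1)` and integer parts `u`, `v`, the inequalities `0 <
    -- (a + u) - (b + v) < 1` force `a ≠ b`, and `u = v + 1` or `u = v` according as `b > a` or not.
    have key : ∀ i : Fin (n + 1),
        (e i.castSucc : ℚ) / padSequence s i.castSucc ≠ (e i.succ : ℚ) / padSequence s i.succ ∧
        Y i.succ / padSequence s i.succ = Y i.castSucc / padSequence s i.castSucc +
          if (e i.castSucc : ℚ) / padSequence s i.castSucc >
            (e i.succ : ℚ) / padSequence s i.succ then 1 else 0 := by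
      intro i
      have h := hx i
      rw [hdiv, hdiv] at h
      obtain ⟨a0, a1⟩ := div_mem_Ico (helt i.succ)
      obtain ⟨b0, b1⟩ := div_mem_Ico (helt i.castSucc)
      generalize (e i.succ : ℚ) / padSequence s i.succ = a at *
      generalize (e i.castSucc : ℚ) / padSequence s i.castSucc = b at *
      generalize Y i.succ / padSequence s i.succ = u at *
      generalize Y i.castSucc / padSequence s i.castSucc = v at *
      constructor
      · rintro rfl
        have h1 : (v : ℚ) < u := by linarith
        have h2 : (u : ℚ) < v + 1 := by linarith
        norm_cast at h1 h2
        omega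
      · split_ifs with hab
        · have h1 : (v : ℚ) < u := by linarith
          have h2 : (u : ℚ) < v + 2 := by linarith
          norm_cast at h1 h2
          omega
        · have h1 : (v : ℚ) < u + 1 := by linarith
          have h2 : (u : ℚ) < v + 1 := by linarith
          norm_cast at h1 h2
          omega
    have hmem : e ∈ restrictedInversionSequences s := ⟨helt, fun i => (key i).1⟩
    have hd : ∀ i, Y i / padSequence s i = desCountBefore s e i := by
      intro i
      induction i using Fin.induction with
      | zero => simp [desCountBefore_zero, hY]
      | succ i ih =>
        rw [(key i).2, ih, desCountBefore_succ]
        push_cast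
        rfl
    have hpad : ∀ i, padWith 0 (boxPointOfSequence s e).1 (boxPointOfSequence s e).2 i = Y i :=
      fun i => by rw [padWith_boxPointOfSequence hmem, ← hd, ← hYe]
    refine ⟨e, hmem, ?_⟩
    rw [forall_fin_add_two] at hpad
    simp only [padWith_castSucc_succ, padWith_last, hY] at hpad
    exact Prod.ext (funext hpad.2.1) hpad.2.2

theorem sDerangementPolynomial_eq_finsum (hs : ∀ i, 0 < s i) :
    sDerangementPolynomial s = ∑ᶠ e ∈ restrictedInversionSequences s, X ^ desCount s e := by
  refine (finsum_mem_eq_of_bijOn _ (bijOn_boxPointOfSequence hs) fun e _ => ?_).symm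
  simp [boxPointOfSequence]

end lectureHall

theorem derangementPolynomial_eq_finsum (n : ℕ) :
    derangementPolynomial n = ∑ᶠ π ∈ derangements (Fin n), X ^ excCount π := by
  rw [← finsum_set_coe_eq_finsum_mem, finsum_eq_sum_of_fintype]
  rfl

/-! ### Reading cycles from words -/

/-- The words that describe derangements. Here `p` is the letter preceding the word and `m` is the
number of elements that are still available. -/
inductive IsCycleWord : ℕ → ℕ → List ℕ → Prop
  | last {p : ℕ} (hp : p ≠ 0) : IsCycleWord p 0 [0]
  | zero {p m : ℕ} {w : List ℕ} (hp : p ≠ 0) (hw : IsCycleWord 0 m w) :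
      IsCycleWord p (m + 1) (0 :: w)
  | succ {p m j : ℕ} {w : List ℕ} (hj : j ≤ m) (hw : IsCycleWord (j + 1) m w) :
      IsCycleWord p (m + 1) ((j + 1) :: w)

/-- The number of pairs of consecutive letters `p, q` with `q ≠ 0` and `p ≤ q` in the word that
starts with `p` and continues with the given list. -/
def weakAscentCount : ℕ → List ℕ → ℕ
  | _, [] => 0
  | p, q :: w => (if q ≠ 0 ∧ p ≤ q then 1 else 0) + weakAscentCount q w

section cycles

variable {n : ℕ}

/-- The states occurring while a word is read: `p` is the last letter read, `A` is the list of
available elements and `h :: t` is the current cycle. -/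
structure IsReadState (p : ℕ) (A : List (Fin n)) (h : Fin n) (t : List (Fin n)) : Prop where
  sorted : A.Pairwise (· < ·)
  nodup : ((h :: t) ++ A).Nodup
  head_lt : ∀ y ∈ t ++ A, h < y
  eq_zero_iff : p = 0 ↔ t = []
  last_lt_iff : ∀ (i : ℕ) (hi : i < A.length),
    (h :: t).getLast (List.cons_ne_nil _ _) < A[i] ↔ p ≤ i + 1

/-- The permutation `π` moves exactly the elements of `c` and `A`, and maps every element of `c` but
the last one to the next element of `c`. -/
structure Extends (π : Equiv.Perm (Fin n)) (A c : List (Fin n)) : Prop where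
  ne_iff : ∀ y, π y ≠ y ↔ y ∈ c ∨ y ∈ A
  chain : c.IsChain fun y z => π y = z

/-- Once `A[j]` is removed, the remaining elements above it are those at index `j` or later; this is
`last_lt_iff` for the letter `j + 1`. -/
theorem IsReadState.succ {p : ℕ} {A : List (Fin n)} {h : Fin n} {t : List (Fin n)}
    (H : IsReadState p A h t) {j : ℕ} (hj : j < A.length) :
    IsReadState (j + 1) (A.eraseIdx j) h (t ++ [A[j]]) := by
  have hperm : (t ++ A).Perm (t ++ [A[j]] ++ A.eraseIdx j) := by
    simpa using (List.getElem_cons_eraseIdx_perm hj).symm.append_left t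
  refine ⟨H.sorted.sublist (List.eraseIdx_sublist _ _), ?_, ?_, by simp, ?_⟩
  · exact (hperm.cons h).nodup_iff.1 H.nodup
  · intro y hy
    exact H.head_lt y (hperm.mem_iff.2 hy)
  · intro i hi
    have hlast : (h :: (t ++ [A[j]])).getLast (List.cons_ne_nil _ _) = A[j] := by simp
    rw [hlast, List.getElem_eraseIdx]
    have hi' : i < A.length - 1 := by rwa [List.length_eraseIdx_of_lt hj] at hi
    have hs := List.pairwise_iff_getElem.1 H.sorted
    split_ifs with hij
    · have := hs i j (by omega) hj hij
      constructor
      · intro h'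
        exact (lt_asymm this h').elim
      · omega
    · have := hs j (i + 1) hj (by omega) (by omega)
      exact ⟨fun _ => by omega, fun _ => this⟩

theorem IsReadState.zero {p : ℕ} {a : Fin n} {A : List (Fin n)} {h : Fin n} {t : List (Fin n)}
    (H : IsReadState p (a :: A) h t) : IsReadState 0 A a [] := by
  have hs := List.pairwise_cons.1 H.sorted
  refine ⟨hs.2, ?_, fun y hy => hs.1 y (by simpa using hy), by simp, fun i hi => ?_⟩
  · exact (List.nodup_append.1 H.nodup).2.1
  · simpa using hs.1 _ (List.getElem_mem hi)

theorem IsReadState.nodup_cycle {p : ℕ} {A : List (Fin n)} {h : Fin n} {t : List (Fin n)}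
    (H : IsReadState p A h t) : (h :: t).Nodup :=
  (List.nodup_append.1 H.nodup).1

theorem IsReadState.notMem_cycle {p : ℕ} {A : List (Fin n)} {h : Fin n} {t : List (Fin n)}
    (H : IsReadState p A h t) {y : Fin n} (hy : y ∈ A) : y ∉ h :: t :=
  fun h' => (List.nodup_append.1 H.nodup).2.2 y h' y hy rfl

theorem IsReadState.not_last_lt_head {p : ℕ} {A : List (Fin n)} {h : Fin n} {t : List (Fin n)}
    (H : IsReadState p A h t) : ¬ (h :: t).getLast (List.cons_ne_nil _ _) < h := by
  rcases List.mem_cons.1 (List.getLast_mem (List.cons_ne_nil h t)) with h' | h'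
  · exact h'.not_lt
  · exact (H.head_lt _ (List.mem_append_left _ h')).not_gt

/-- This is where the absence of two consecutive zeros excludes fixed points. -/
theorem IsReadState.two_le_length {p : ℕ} {A : List (Fin n)} {h : Fin n} {t : List (Fin n)}
    (H : IsReadState p A h t) (hp : p ≠ 0) : 2 ≤ (h :: t).length := by
  have := List.length_pos_iff.2 (mt H.eq_zero_iff.2 hp)
  rw [List.length_cons]
  omega

theorem isChain_formPerm {c : List (Fin n)} (hc : c.Nodup) :
    c.IsChain fun y z => c.formPerm y = z :=
  List.isChain_iff_getElem.2 fun i hi => List.formPerm_apply_lt_getElem c hc i hi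

/-- Closing off a cycle. -/
theorem Extends.formPerm_mul {π : Equiv.Perm (Fin n)} {A c c' : List (Fin n)}
    (hπ : Extends π A c') (hdisj : ∀ y ∈ c, y ∉ c' ∧ y ∉ A) :
    (∀ y ∈ c, (c.formPerm * π) y = c.formPerm y) ∧ (∀ y ∉ c, (c.formPerm * π) y = π y) := by
  have hfix : ∀ y ∈ c, π y = y := fun y hy => by
    by_contra h
    exact ((hπ.ne_iff y).1 h).elim (hdisj y hy).1 (hdisj y hy).2
  refine ⟨fun y hy => by rw [Equiv.Perm.mul_apply, hfix y hy], fun y hy => ?_⟩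
  rw [Equiv.Perm.mul_apply, List.formPerm_apply_of_notMem]
  intro h
  exact hy (π.injective (hfix _ h) ▸ h)

theorem Extends.closeCycle {π : Equiv.Perm (Fin n)} {A c c' : List (Fin n)}
    (hπ : Extends π A c') (hc : c.Nodup) (hlen : 2 ≤ c.length)
    (hdisj : ∀ y ∈ c, y ∉ c' ∧ y ∉ A) : Extends (c.formPerm * π) (c' ++ A) c := by
  obtain ⟨h1, h2⟩ := hπ.formPerm_mul hdisj
  refine ⟨fun y => ?_, ?_⟩
  · by_cases hy : y ∈ c
    · rw [h1 y hy]
      simpa [hy] using (List.formPerm_apply_mem_ne_self_iff _ hc y hy).2 hlen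
    · rw [h2 y hy, hπ.ne_iff, List.mem_append]
      simp [hy]
  · refine List.isChain_iff_getElem.2 fun i hi => ?_
    rw [h1 _ (List.getElem_mem _), List.formPerm_apply_lt_getElem c hc i hi]

theorem Extends.apply_getLast {π : Equiv.Perm (Fin n)} {A : List (Fin n)} {h : Fin n}
    {t : List (Fin n)} {a : Fin n} (hπ : Extends π A (h :: (t ++ [a]))) :
    π ((h :: t).getLast (List.cons_ne_nil _ _)) = a := by
  have := hπ.chain
  rw [← List.cons_append, List.isChain_append] at this
  exact this.2.2 _ (List.getLast_mem_getLast? _) a (by simp)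

/-- The permutation read from a word. -/
theorem IsCycleWord.extends_cyclesFromWord {p m : ℕ} {w : List ℕ} (hw : IsCycleWord p m w) :
    ∀ {A : List (Fin n)} {h : Fin n} {t : List (Fin n)}, A.length = m → IsReadState p A h t →
      Extends (cyclesFromWord w A (h :: t)) A (h :: t) ∧
      ((h :: t).getLast (List.cons_ne_nil _ _) :: A).countP
        (fun y => y < cyclesFromWord w A (h :: t) y) = weakAscentCount p w := by
  -- The count runs over the elements whose images are still open: the last one of the current cycle
  -- and the available ones. Each letter settles one image.
  induction hw with
  | last hp =>
    intro A h t hA H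
    obtain rfl := List.length_eq_zero_iff.1 hA
    have e : cyclesFromWord [0] [] (h :: t) = (h :: t).formPerm := by simp [cyclesFromWord]
    rw [e]
    refine ⟨⟨fun y => ?_, isChain_formPerm H.nodup_cycle⟩, ?_⟩
    · simp only [List.not_mem_nil, or_false]
      exact ⟨List.mem_of_formPerm_apply_ne, fun hy =>
        (List.formPerm_apply_mem_ne_self_iff _ H.nodup_cycle y hy).2 (H.two_le_length hp)⟩
    · rw [List.countP_cons, List.formPerm_apply_getLast, if_neg (by simpa using H.not_last_lt_head)]
      simp [weakAscentCount]
  | @zero p m w hp _ ih =>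
    intro A h t hA H
    rcases A with _ | ⟨a, A⟩
    · simp at hA
    obtain ⟨h1, h2⟩ := ih (by simpa using hA) H.zero
    have e : cyclesFromWord (0 :: w) (a :: A) (h :: t) =
        (h :: t).formPerm * cyclesFromWord w A [a] := by simp [cyclesFromWord]
    rw [e]
    have hdisj : ∀ y ∈ h :: t, y ∉ [a] ∧ y ∉ A := fun y hy => by
      have : y ∉ a :: A := fun hy' => H.notMem_cycle hy' hy
      simpa using this
    obtain ⟨h3, h4⟩ := h1.formPerm_mul hdisj
    refine ⟨h1.closeCycle H.nodup_cycle (H.two_le_length hp) hdisj, ?_⟩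
    rw [List.countP_cons, h3 _ (List.getLast_mem _), List.formPerm_apply_getLast,
      if_neg (by simpa using H.not_last_lt_head), weakAscentCount, if_neg (by simp), add_zero,
      zero_add, ← h2]
    refine List.countP_congr fun y hy => ?_
    rw [h4 y (H.notMem_cycle hy)]
  | @succ p m j w hj _ ih =>
    intro A h t hA H
    have hj' : j < A.length := by omega
    obtain ⟨h1, h2⟩ := ih (by rw [List.length_eraseIdx_of_lt hj']; omega) (H.succ hj')
    have e : cyclesFromWord ((j + 1) :: w) A (h :: t) =
        cyclesFromWord w (A.eraseIdx j) (h :: (t ++ [A[j]])) := by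
      simp [cyclesFromWord, hj']
    rw [e]
    have hperm := (List.getElem_cons_eraseIdx_perm hj').symm
    refine ⟨⟨fun y => ?_, ?_⟩, ?_⟩
    · rw [h1.ne_iff, hperm.mem_iff]
      simp [or_assoc]
    · have := h1.chain
      rw [← List.cons_append] at this
      exact this.left_of_append
    · rw [List.countP_cons, h1.apply_getLast, hperm.countP_eq, weakAscentCount, ← h2, add_comm]
      -- The arc from the last element to `A[j]` is an excedance exactly when the letters `p`, `j +
      -- 1` form a weak ascent.
      have h3 := H.last_lt_iff j hj'
      have h4 : (h :: (t ++ [A[j]])).getLast (List.cons_ne_nil _ _) = A[j] := by simp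
      rw [h4]
      congr 1
      simp only [h3, decide_eq_true_eq]
      simp

theorem IsCycleWord.apply_getLast_zero {p m : ℕ} {w : List ℕ} {A : List (Fin n)} {h : Fin n}
    {t : List (Fin n)} (hw : IsCycleWord p m (0 :: w)) (hA : A.length = m)
    (H : IsReadState p A h t) :
    cyclesFromWord (0 :: w) A (h :: t) ((h :: t).getLast (List.cons_ne_nil _ _)) = h := by
  cases hw with
  | last hp =>
    obtain rfl := List.length_eq_zero_iff.1 hA
    simp [cyclesFromWord]
  | zero hp hw =>
    rcases A with _ | ⟨a, A⟩
    · simp at hA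
    obtain ⟨h1, -⟩ := hw.extends_cyclesFromWord (by simpa using hA) H.zero
    have e : cyclesFromWord (0 :: w) (a :: A) (h :: t) =
        (h :: t).formPerm * cyclesFromWord w A [a] := by simp [cyclesFromWord]
    have hdisj : ∀ y ∈ h :: t, y ∉ [a] ∧ y ∉ A := fun y hy => by
      have : y ∉ a :: A := fun hy' => H.notMem_cycle hy' hy
      simpa using this
    rw [e, (h1.formPerm_mul hdisj).1 _ (List.getLast_mem _),
      List.formPerm_apply_getLast]

theorem IsCycleWord.apply_getLast_succ {p m j : ℕ} {w : List ℕ} {A : List (Fin n)} {h : Fin n}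
    {t : List (Fin n)} (hw : IsCycleWord p m ((j + 1) :: w)) (hA : A.length = m)
    (H : IsReadState p A h t) : ∃ hj : j < A.length,
      cyclesFromWord ((j + 1) :: w) A (h :: t) ((h :: t).getLast (List.cons_ne_nil _ _)) =
        A[j] := by
  cases hw with
  | succ hj hw =>
    have hj' : j < A.length := by omega
    obtain ⟨h1, -⟩ := hw.extends_cyclesFromWord
      (by rw [List.length_eraseIdx_of_lt hj']; omega) (H.succ hj')
    refine ⟨hj', ?_⟩
    have e : cyclesFromWord ((j + 1) :: w) A (h :: t) =
        cyclesFromWord w (A.eraseIdx j) (h :: (t ++ [A[j]])) := by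
      simp [cyclesFromWord, hj']
    rw [e, h1.apply_getLast]

/-- The image of the last element of the current cycle reveals the next letter: it is the head,
outside `A`, for the letter `0`, and `A[j]` for `j + 1`; `A` has no repetitions. -/
theorem IsCycleWord.cyclesFromWord_injective {p m : ℕ} {w : List ℕ} (hw : IsCycleWord p m w) :
    ∀ {w' : List ℕ} {A : List (Fin n)} {h : Fin n} {t : List (Fin n)}, IsCycleWord p m w' →
      A.length = m → IsReadState p A h t →
      cyclesFromWord w A (h :: t) = cyclesFromWord w' A (h :: t) → w = w' := by
  have hne : ∀ {p m j : ℕ} {w w' : List ℕ} {A : List (Fin n)} {h : Fin n} {t : List (Fin n)},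
      IsCycleWord p m (0 :: w) → IsCycleWord p m ((j + 1) :: w') → A.length = m →
      IsReadState p A h t →
      cyclesFromWord (0 :: w) A (h :: t) ≠ cyclesFromWord ((j + 1) :: w') A (h :: t) := by
    intro p m j w w' A h t h1 h2 hA H he
    obtain ⟨hj, h3⟩ := h2.apply_getLast_succ hA H
    rw [← he, h1.apply_getLast_zero hA H] at h3
    exact H.notMem_cycle (List.getElem_mem hj) (h3 ▸ List.mem_cons_self)
  induction hw with
  | last hp =>
    intro w' A h t hw' _ _ _
    cases hw'
    rfl
  | @zero p m w hp hw ih =>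
    intro w' A h t hw' hA H he
    cases hw' with
    | zero _ hw' =>
      rcases A with _ | ⟨a, A⟩
      · simp at hA
      simp only [cyclesFromWord, List.drop_one, List.tail_cons, List.take_one, List.head?_cons,
        Option.toList_some, mul_right_inj] at he
      rw [ih hw' (by simpa using hA) H.zero he]
    | succ hj hw' => exact (hne (.zero hp hw) (.succ hj hw') hA H he).elim
  | @succ p m j w hj hw ih =>
    intro w' A h t hw' hA H he
    cases hw' with
    | zero hp hw' => exact (hne (.zero hp hw') (.succ hj hw) hA H he.symm).elim
    | @succ _ _ j' w' hj' hw' =>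
      obtain ⟨h1, h2⟩ := (IsCycleWord.succ (p := p) hj hw).apply_getLast_succ hA H
      obtain ⟨h3, h4⟩ := (IsCycleWord.succ (p := p) hj' hw').apply_getLast_succ hA H
      have hA' := (List.nodup_append.1 H.nodup).2.1
      obtain rfl : j = j' := by rw [← hA'.getElem_inj_iff (hi := h1) (hj := h3), ← h2, ← h4, he]
      simp only [cyclesFromWord, List.getElem?_eq_getElem h1, Option.toList_some,
        List.cons_append] at he
      rw [ih hw' (by rw [List.length_eraseIdx_of_lt h1]; omega) (H.succ h1) he]

/-! ### Recovering a word from a derangement -/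

/-- The image is itself moved, so it lies in the current cycle; every element there except the head
is already the image of its predecessor. -/
theorem Extends.apply_getLast_eq_head {π : Equiv.Perm (Fin n)} {A : List (Fin n)} {h : Fin n}
    {t : List (Fin n)} (hπ : Extends π A (h :: t)) (hc : (h :: t).Nodup)
    (hA : π ((h :: t).getLast (List.cons_ne_nil _ _)) ∉ A) :
    π ((h :: t).getLast (List.cons_ne_nil _ _)) = h := by
  set x := (h :: t).getLast (List.cons_ne_nil _ _) with hx
  have h1 : π x ≠ x := (hπ.ne_iff x).2 (Or.inl (List.getLast_mem _))
  have h2 : π (π x) ≠ π x := fun h' => h1 (π.injective h')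
  have h3 : π x ∈ h :: t := ((hπ.ne_iff _).1 h2).resolve_right hA
  obtain ⟨i, hi, hix⟩ := List.getElem_of_mem h3
  rcases i with _ | i
  · simpa using hix.symm
  · rw [← List.isChain_iff_getElem.1 hπ.chain i hi] at hix
    have h4 := π.injective hix
    rw [hx, List.getLast_eq_getElem, hc.getElem_inj_iff] at h4
    omega

theorem Extends.apply_eq_formPerm {π : Equiv.Perm (Fin n)} {A : List (Fin n)} {h : Fin n}
    {t : List (Fin n)} (hπ : Extends π A (h :: t)) (hc : (h :: t).Nodup)
    (hlast : π ((h :: t).getLast (List.cons_ne_nil _ _)) = h) {y : Fin n} (hy : y ∈ h :: t) :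
    π y = (h :: t).formPerm y := by
  obtain ⟨i, hi, rfl⟩ := List.getElem_of_mem hy
  by_cases hi' : i + 1 < (h :: t).length
  · rw [List.formPerm_apply_lt_getElem _ hc i hi', List.isChain_iff_getElem.1 hπ.chain i hi']
  · have : (h :: t)[i] = (h :: t).getLast (List.cons_ne_nil _ _) := by
      rw [List.getLast_eq_getElem]
      congr 1
      omega
    rw [this, hlast, List.formPerm_apply_getLast]

/-- If the image of the last element is available, its index gives the next letter. Otherwise the
cycle closes, the letter is `0`, and the cycle is divided out of `π`. -/
theorem Extends.exists_isCycleWord (m : ℕ) :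
    ∀ {π : Equiv.Perm (Fin n)} {p : ℕ} {A : List (Fin n)} {h : Fin n} {t : List (Fin n)},
      A.length = m → IsReadState p A h t → Extends π A (h :: t) →
      ∃ w, IsCycleWord p m w ∧ cyclesFromWord w A (h :: t) = π := by
  -- If `p = 0`, the cycle is `[h]`, and closing it would make `h` a fixed point.
  have hp : ∀ {π : Equiv.Perm (Fin n)} {p : ℕ} {A : List (Fin n)} {h : Fin n} {t : List (Fin n)},
      IsReadState p A h t → Extends π A (h :: t) →
      π ((h :: t).getLast (List.cons_ne_nil _ _)) = h → p ≠ 0 := by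
    intro π p A h t H hπ hlast h0
    obtain rfl := H.eq_zero_iff.1 h0
    exact (hπ.ne_iff h).2 (Or.inl List.mem_cons_self) hlast
  induction m with
  | zero =>
    intro π p A h t hA H hπ
    obtain rfl := List.length_eq_zero_iff.1 hA
    have hlast := hπ.apply_getLast_eq_head H.nodup_cycle List.not_mem_nil
    refine ⟨[0], .last (hp H hπ hlast), ?_⟩
    have e : cyclesFromWord [0] [] (h :: t) = (h :: t).formPerm := by simp [cyclesFromWord]
    rw [e]
    ext1 y
    by_cases hy : y ∈ h :: t
    · exact (hπ.apply_eq_formPerm H.nodup_cycle hlast hy).symm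
    · rw [List.formPerm_apply_of_notMem hy]
      by_contra h'
      exact ((hπ.ne_iff y).1 (Ne.symm h')).elim hy List.not_mem_nil
  | succ m ih =>
    intro π p A h t hA H hπ
    by_cases hmem : π ((h :: t).getLast (List.cons_ne_nil _ _)) ∈ A
    · obtain ⟨j, hj, hjx⟩ := List.getElem_of_mem hmem
      have hext : Extends π (A.eraseIdx j) (h :: (t ++ [A[j]])) := by
        refine ⟨fun y => ?_, ?_⟩
        · rw [hπ.ne_iff, ← (List.getElem_cons_eraseIdx_perm hj).mem_iff]
          simp [or_assoc]
        · rw [← List.cons_append, List.isChain_append]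
          refine ⟨hπ.chain, List.isChain_singleton _, ?_⟩
          intro y hy z hz
          rw [List.getLast?_eq_getLast_of_ne_nil (List.cons_ne_nil _ _), Option.mem_some_iff] at hy
          rw [List.head?_cons, Option.mem_some_iff] at hz
          rw [← hy, ← hz, hjx]
      obtain ⟨w, hw, he⟩ := ih (by rw [List.length_eraseIdx_of_lt hj]; omega) (H.succ hj) hext
      refine ⟨(j + 1) :: w, .succ (by omega) hw, ?_⟩
      rw [← he]
      simp [cyclesFromWord, hj]
    · have hlast := hπ.apply_getLast_eq_head H.nodup_cycle hmem
      have hform := fun y => hπ.apply_eq_formPerm H.nodup_cycle hlast (y := y)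
      rcases A with _ | ⟨a, A⟩
      · simp at hA
      have hin : ∀ y ∈ h :: t, ((h :: t).formPerm⁻¹ * π) y = y := fun y hy => by
        rw [Equiv.Perm.mul_apply, hform y hy, Equiv.Perm.inv_eq_iff_eq]
      have hout : ∀ y ∉ h :: t, ((h :: t).formPerm⁻¹ * π) y = π y := fun y hy => by
        rw [Equiv.Perm.mul_apply, Equiv.Perm.inv_eq_iff_eq, List.formPerm_apply_of_notMem]
        intro hmem'
        set z := (h :: t).formPerm⁻¹ (π y) with hz
        have hz' : (h :: t).formPerm z = π y := by rw [hz]; exact (Equiv.apply_symm_apply _ _)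
        have hzmem : z ∈ h :: t := List.mem_of_formPerm_apply_mem (hz' ▸ hmem')
        rw [← hform z hzmem] at hz'
        exact hy (π.injective hz' ▸ hzmem)
      have hext : Extends ((h :: t).formPerm⁻¹ * π) A [a] := by
        refine ⟨fun y => ?_, List.isChain_singleton _⟩
        by_cases hy : y ∈ h :: t
        · rw [hin y hy]
          have : y ∉ a :: A := fun hy' => H.notMem_cycle hy' hy
          simpa using this
        · rw [hout y hy, hπ.ne_iff]
          simp [hy]
      obtain ⟨w, hw, he⟩ := ih (by simpa using hA) H.zero hext
      refine ⟨0 :: w, .zero (hp H hπ hlast) hw, ?_⟩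
      simp [cyclesFromWord, he]

end cycles

/-! ### Restricted inversion sequences as words -/

theorem isCycleWord_cons_iff {p m q : ℕ} {w : List ℕ} :
    IsCycleWord p (m + 1) (q :: w) ↔ q ≤ m + 1 ∧ ¬(q = 0 ∧ p = 0) ∧ IsCycleWord q m w := by
  constructor
  · rintro (_ | ⟨hp, hw⟩ | ⟨hj, hw⟩)
    · exact ⟨Nat.zero_le _, fun h => hp h.2, hw⟩
    · exact ⟨Nat.succ_le_succ hj, fun h => absurd h.1 (Nat.succ_ne_zero _), hw⟩
  · rintro ⟨h1, h2, h3⟩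
    rcases q with _ | q
    · exact .zero (fun h => h2 ⟨rfl, h⟩) h3
    · exact .succ (Nat.le_of_succ_le_succ h1) h3

theorem IsCycleWord.length_eq {p m : ℕ} {w : List ℕ} (hw : IsCycleWord p m w) :
    w.length = m + 1 := by
  induction hw with
  | last => rfl
  | zero _ _ ih => rw [List.length_cons, ih]
  | succ _ _ ih => rw [List.length_cons, ih]

theorem reverse_ofFn_succ {m : ℕ} (e : Fin (m + 1) → ℕ) :
    (List.ofFn e).reverse = e (Fin.last m) :: (List.ofFn fun i : Fin m => e i.castSucc).reverse := by
  rw [List.ofFn_succ_last, List.reverse_append]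
  rfl

/-- When `e i` is read, exactly `i` elements are available, whence the bound. -/
theorem isCycleWord_reverse_ofFn_iff {m : ℕ} (p : ℕ) (e : Fin (m + 1) → ℕ) :
    IsCycleWord p m (List.ofFn e).reverse ↔ (∀ i, e i ≤ (i : ℕ)) ∧
      (∀ i : Fin m, ¬(e i.castSucc = 0 ∧ e i.succ = 0)) ∧ ¬(e (Fin.last m) = 0 ∧ p = 0) := by
  induction m generalizing p with
  | zero =>
    rw [reverse_ofFn_succ, List.ofFn_zero, List.reverse_nil]
    rw [show (∀ i : Fin (0 + 1), e i ≤ (i : ℕ)) ↔ e (Fin.last 0) ≤ 0 from Fin.forall_fin_one]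
    simp only [IsEmpty.forall_iff, true_and]
    generalize e (Fin.last 0) = q
    constructor
    · rintro ⟨hp⟩
      exact ⟨le_rfl, fun h => hp h.2⟩
    · rintro ⟨h1, h2⟩
      obtain rfl := Nat.le_zero.1 h1
      exact .last fun h => h2 ⟨rfl, h⟩
  | succ m ih =>
    rw [reverse_ofFn_succ, isCycleWord_cons_iff, ih, Fin.forall_fin_succ' (P := fun i => e i ≤ i),
      Fin.forall_fin_succ' (P := fun i : Fin (m + 1) => ¬(e i.castSucc = 0 ∧ e i.succ = 0))]
    simp only [Fin.val_castSucc, Fin.val_last, Fin.succ_last, ← Fin.succ_castSucc]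
    tauto

theorem weakAscentCount_reverse_ofFn {m : ℕ} (p : ℕ) (e : Fin (m + 1) → ℕ) :
    weakAscentCount p (List.ofFn e).reverse =
      (Finset.univ.filter fun i : Fin m => e i.castSucc ≠ 0 ∧ e i.succ ≤ e i.castSucc).card +
        if e (Fin.last m) ≠ 0 ∧ p ≤ e (Fin.last m) then 1 else 0 := by
  induction m generalizing p with
  | zero =>
    rw [reverse_ofFn_succ, List.ofFn_zero, List.reverse_nil]
    simp [weakAscentCount]
  | succ m ih =>
    rw [reverse_ofFn_succ, weakAscentCount, ih, Finset.card_filter, Finset.card_filter,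
      Fin.sum_univ_castSucc
        (fun i : Fin (m + 1) => if e i.castSucc ≠ 0 ∧ e i.succ ≤ e i.castSucc then 1 else 0)]
    simp only [Fin.succ_last, ← Fin.succ_castSucc]
    ring

section consecutive

variable {n : ℕ} {s : Fin n → ℕ}

theorem padSequence_castSucc (hs : ∀ i, s i = (i : ℕ) + 2) (i : Fin (n + 1)) :
    padSequence s i.castSucc = i + 1 := by
  induction i using Fin.cases with
  | zero => rfl
  | succ i =>
    rw [← Fin.succ_castSucc, padSequence_eq_padWith, padWith_castSucc_succ, hs, Fin.val_succ]

theorem padSequence_last (s : Fin n → ℕ) : padSequence s (Fin.last n).succ = 1 :=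
  padWith_last 1 s 1

/-- Cross-multiplied, the inequality is `b (k + 1) < a (k + 1) + a`, where `a < k + 1`. -/
theorem div_succ_lt_div_succ_iff {a b k : ℕ} (ha : a ≤ k) :
    (b : ℚ) / (k + 1 + 1 : ℕ) < (a : ℚ) / (k + 1 : ℕ) ↔ a ≠ 0 ∧ b ≤ a := by
  rw [div_lt_div_iff₀ (by positivity) (by positivity)]
  norm_cast
  constructor
  · intro h
    refine ⟨?_, ?_⟩
    · rintro rfl
      simp at h
    · by_contra! hab
      nlinarith
  · rintro ⟨h1, h2⟩
    have : 0 < a := Nat.pos_of_ne_zero h1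
    nlinarith

/-- Equality gives `b (k + 1) = a (k + 1) + a`, so `k + 1` divides `a ≤ k`. -/
theorem div_succ_eq_div_succ_iff {a b k : ℕ} (ha : a ≤ k) :
    (a : ℚ) / (k + 1 : ℕ) = (b : ℚ) / (k + 1 + 1 : ℕ) ↔ a = 0 ∧ b = 0 := by
  rw [div_eq_div_iff (by positivity) (by positivity)]
  norm_cast
  constructor
  · intro h
    have h1 : a = 0 := by
      by_contra h0
      have h2 : a * (k + 1 + 1) = a * (k + 1) + a := by ring
      have h3 : k + 1 ∣ a := (Nat.dvd_add_right (Dvd.intro_left a rfl)).1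
        (h2 ▸ h ▸ Dvd.intro_left b rfl)
      exact absurd (Nat.le_of_dvd (Nat.pos_of_ne_zero h0) h3) (by omega)
    subst h1
    simpa using h.symm
  · rintro ⟨rfl, rfl⟩
    simp

/-- The forced final zero is read first and opens the first cycle, which leaves `n` elements and the
preceding letter `0`. -/
theorem mem_restrictedInversionSequences_iff (hs : ∀ i, s i = (i : ℕ) + 2) (e : Fin (n + 2) → ℕ) :
    e ∈ restrictedInversionSequences s ↔ e (Fin.last n).succ = 0 ∧
      IsCycleWord 0 n (List.ofFn fun i : Fin (n + 1) => e i.castSucc).reverse := by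
  rw [isCycleWord_reverse_ofFn_iff, restrictedInversionSequences, Set.mem_ofPred_eq,
    inversionSequences, Set.mem_ofPred_eq,
    Fin.forall_fin_succ' (P := fun i => e i < padSequence s i),
    Fin.forall_fin_succ' (P := fun i : Fin (n + 1) =>
      (e i.castSucc : ℚ) / padSequence s i.castSucc ≠ (e i.succ : ℚ) / padSequence s i.succ),
    ← Fin.succ_last, padSequence_last, Nat.lt_one_iff]
  simp only [padSequence_castSucc hs, Nat.lt_succ_iff, Fin.succ_castSucc, Fin.val_castSucc,
    Fin.val_last, Fin.val_succ]
  constructor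
  · rintro ⟨⟨h1, h2⟩, h3, h4⟩
    refine ⟨h2, h1, fun i h => h3 i ?_, fun h => h4 ?_⟩
    · exact (div_succ_eq_div_succ_iff (h1 i.castSucc)).2 h
    · rw [h2, h.1]
      simp
  · rintro ⟨h1, h2, h3, h4⟩
    refine ⟨⟨h2, h1⟩, fun i h => h3 i ?_, fun h => h4 ⟨?_, trivial⟩⟩
    · exact (div_succ_eq_div_succ_iff (h2 i.castSucc)).1 h
    · rw [h1, Nat.cast_zero, zero_div, div_eq_zero_iff] at h
      rcases h with h | h
      · exact_mod_cast h
      · exact absurd h (by positivity)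

theorem desCount_eq_weakAscentCount (hs : ∀ i, s i = (i : ℕ) + 2) {e : Fin (n + 2) → ℕ}
    (he : e ∈ restrictedInversionSequences s) :
    desCount s e =
      weakAscentCount 0 (List.ofFn fun i : Fin (n + 1) => e i.castSucc).reverse := by
  have h := (mem_restrictedInversionSequences_iff hs e).1 he
  have h1 := ((isCycleWord_reverse_ofFn_iff _ _).1 h.2).1
  rw [weakAscentCount_reverse_ofFn, desCount, Finset.card_filter, Finset.card_filter,
    Fin.sum_univ_castSucc, h.1, padSequence_last]
  simp only [padSequence_castSucc hs, Fin.succ_castSucc, Fin.val_castSucc, Fin.val_last,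
    Fin.val_succ]
  congr 1
  · refine Finset.sum_congr rfl fun i _ => ?_
    congr 1
    exact propext (div_succ_lt_div_succ_iff (h1 i.castSucc))
  -- The last comparison has denominator `1` on the right instead of continuing the pattern; against
  -- `0` it only says that the entry before the final zero is nonzero.
  · congr 1
    rw [Nat.cast_zero, zero_div, gt_iff_lt, div_pos_iff_of_pos_right (by positivity),
      Nat.cast_pos, Nat.pos_iff_ne_zero]
    simp

theorem isReadState_initial (n : ℕ) :
    IsReadState 0 ((List.finRange n).map Fin.succ) (0 : Fin (n + 1)) [] := by
  refine ⟨?_, ?_, ?_, by simp, fun i hi => ?_⟩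
  · rw [List.pairwise_map]
    exact (List.pairwise_lt_finRange n).imp Fin.succ_lt_succ_iff.2
  · rw [List.singleton_append, ← List.finRange_succ]
    exact List.nodup_finRange _
  · intro y hy
    obtain ⟨i, -, rfl⟩ := List.mem_map.1 hy
    exact Fin.succ_pos i
  · rw [List.getElem_map]
    simp only [List.getLast_singleton, Fin.succ_pos, true_iff]
    exact Nat.zero_le _

theorem inversionSequenceToPerm_eq {e : Fin (n + 2) → ℕ} (he : e (Fin.last n).succ = 0) :
    inversionSequenceToPerm (n + 1) e =
      cyclesFromWord (List.ofFn fun i : Fin (n + 1) => e i.castSucc).reverse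
        ((List.finRange n).map Fin.succ) [0] := by
  rw [inversionSequenceToPerm, reverse_ofFn_succ, ← Fin.succ_last, he, List.finRange_succ]
  simp [cyclesFromWord]

theorem excCount_eq_countP (π : Equiv.Perm (Fin n)) :
    excCount π = (List.finRange n).countP fun y => y < π y := by
  rw [List.countP_eq_length_filter]
  rfl

theorem bijOn_inversionSequenceToPerm (hs : ∀ i, s i = (i : ℕ) + 2) :
    Set.BijOn (inversionSequenceToPerm (n + 1)) (restrictedInversionSequences s)
      (derangements (Fin (n + 1))) := by
  have hH := isReadState_initial n
  have hlen : ((List.finRange n).map Fin.succ).length = n := by simp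
  have hmem : ∀ y : Fin (n + 1), y ∈ [(0 : Fin (n + 1))] ∨ y ∈ (List.finRange n).map Fin.succ := by
    intro y
    rw [← List.mem_append, List.singleton_append, ← List.finRange_succ]
    exact List.mem_finRange y
  refine ⟨fun e he => ?_, fun e he e' he' h => ?_, fun π hπ => ?_⟩
  · rw [mem_restrictedInversionSequences_iff hs] at he
    rw [inversionSequenceToPerm_eq he.1]
    exact fun y => ((he.2.extends_cyclesFromWord hlen hH).1.ne_iff y).2 (hmem y)
  · rw [mem_restrictedInversionSequences_iff hs] at he he'
    rw [inversionSequenceToPerm_eq he.1, inversionSequenceToPerm_eq he'.1] at h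
    have h1 := List.ofFn_injective
      (List.reverse_injective (he.2.cyclesFromWord_injective he'.2 hlen hH h))
    funext i
    induction i using Fin.lastCases with
    | last => rw [← Fin.succ_last, he.1, he'.1]
    | cast i => exact congrFun h1 i
  · obtain ⟨w, hw, rfl⟩ := Extends.exists_isCycleWord (π := π) n hlen hH
      ⟨fun y => ⟨fun _ => hmem y, fun _ => hπ y⟩, List.isChain_singleton _⟩
    have hw' : w.reverse.length = n + 1 := by rw [List.length_reverse, hw.length_eq]
    -- Sequences are read from the right, so the word is reversed and the leading zero of the
    -- reading is appended.
    set e : Fin (n + 2) → ℕ := Fin.snoc (fun i : Fin (n + 1) => w.reverse[i]) 0 with he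
    have h1 : e (Fin.last n).succ = 0 := by rw [he, Fin.succ_last, Fin.snoc_last]
    have h2 : (List.ofFn fun i : Fin (n + 1) => e i.castSucc).reverse = w := by
      rw [List.reverse_eq_iff]
      refine List.ext_getElem (by simp [hw']) fun i _ _ => ?_
      rw [List.getElem_ofFn]
      refine (congrFun he _).trans ?_
      rw [Fin.snoc_castSucc]
      rfl
    refine ⟨e, ?_, ?_⟩
    · rw [mem_restrictedInversionSequences_iff hs, h2]
      exact ⟨h1, hw⟩
    · rw [inversionSequenceToPerm_eq h1, h2]

theorem excCount_inversionSequenceToPerm (hs : ∀ i, s i = (i : ℕ) + 2) {e : Fin (n + 2) → ℕ}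
    (he : e ∈ restrictedInversionSequences s) :
    excCount (inversionSequenceToPerm (n + 1) e) = desCount s e := by
  rw [desCount_eq_weakAscentCount hs he]
  rw [mem_restrictedInversionSequences_iff hs] at he
  rw [excCount_eq_countP, inversionSequenceToPerm_eq he.1,
    ← (he.2.extends_cyclesFromWord (by simp) (isReadState_initial n)).2, List.finRange_succ]
  rfl

theorem sDerangementPolynomial_eq_derangementPolynomial (hs : ∀ i, s i = (i : ℕ) + 2) :
    sDerangementPolynomial s = derangementPolynomial (n + 1) := by
  rw [sDerangementPolynomial_eq_finsum fun i => by rw [hs]; exact Nat.succ_pos _,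
    derangementPolynomial_eq_finsum]
  exact finsum_mem_eq_of_bijOn _ (bijOn_inversionSequenceToPerm hs) fun e he => by
    rw [excCount_inversionSequenceToPerm hs he]

end consecutive

theorem mainTheorem4 (n : ℕ) (hn : 1 ≤ n) (s : Fin (n - 1) → ℕ)
    (hs : ∀ i, s i = (i : ℕ) + 2) :
    sDerangementPolynomial s = derangementPolynomial n ∧
    (Set.BijOn (inversionSequenceToPerm n) (restrictedInversionSequences s)
        (derangements (Fin n)) ∧
      ∀ e ∈ restrictedInversionSequences s,
        excCount (inversionSequenceToPerm n e) = desCount s e) ∧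
    localHPolynomial (barycentricSubdivision (Fin n)) Finset.univ =
      localHStarPolynomial (lectureHallSimplex s) := by
  obtain ⟨n, rfl⟩ := Nat.exists_eq_add_of_le' hn
  have h := sDerangementPolynomial_eq_derangementPolynomial (n := n) hs
  exact ⟨h, ⟨bijOn_inversionSequenceToPerm (n := n) hs,
    fun e he => excCount_inversionSequenceToPerm (n := n) hs he⟩,
    (localHPolynomial_barycentricSubdivision (n + 1)).trans h.symm⟩
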